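/- Let $n\in\mathbb N$, $\|\cdot\|$ the Euclidean norm on $\mathbb R^n$, and $p\ge 2$ an integer. Suppose: (a) $f:\mathbb R^n\to\mathbb R$ is $p$ times continuously differentiable and $f(x)\ge f_{\mathrm{low}}$ for all $x$, for some $f_{\mathrm{low}}\in\mathbb R$; (b) there are $L_1,L_p>0$ with $\|\nabla f(x)-\nabla f(y)\|\le L_1\|x-y\|$ and $\|\mathcal D^pf(x)-\mathcal D^pf(y)\|\le L_p\|x-y\|$ for all $x,y\in\mathbb R^n$, where $\mathcal D^pf(x)$ is the $p$-th derivative of $f$ at $x$, a $p$-linear form with the norm $\|\mathcal T\|=\max\{\mathcal T[h_1,\dots,h_p]:\|h_i\|\le1\}$; (c) $P$ is a probability distribution on a measurable space $\Xi$, and the jointly measurable map $G:\mathbb R^n\times\Xi\to\mathbb R^n$ satisfies, for $\xi\sim P$, $\mathbb E[G(x;\xi)]=\nabla f(x)$ and $\mathbb E[\|G(x;\xi)-\nabla f(x)\|^\alpha]\le\sigma^\alpha$ for all $x\in\mathbb R^n$, for some $\sigma>0$ and $\alpha\in(1,2]$. Consider the following method, whose parameters do not depend on $\alpha$. For integers $k\ge0$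 and $1\le t\le p-1$ set $$\eta_k=\frac1{(k+4)^{(2p+1)/(3p+1)}},\qquad \gamma_k=\frac1{(k+4)^{2p/(3p+1)}},\qquad \gamma_{k,t}=\frac{\gamma_k}{t^2},$$ $$\theta_{k,t}=\frac{\prod_{1\le s\le p-1,\,s\ne t}(1-s^2/\gamma_k)}{(t^2/\gamma_k)\prod_{1\le s\le p-1,\,s\ne t}\big((t^2-s^2)/\gamma_k\big)},$$ and $\gamma_{-1,t}=1$, $\theta_{-1,t}=1/(p-1)$. Given $x^0\in\mathbb R^n$, let $x^{-1}=x^0$, $m^{-1}=0$, and for $k=0,1,2,\dots$ let $$z^{k,t}=x^k+\frac{1-\gamma_{k-1,t}}{\gamma_{k-1,t}}(x^k-x^{k-1})\qquad(1\le t\le p-1),$$ $$m^k=\Big(1-\sum_{t=1}^{p-1}\theta_{k-1,t}\Big)m^{k-1}+\sum_{t=1}^{p-1}\theta_{k-1,t}\,G(z^{k,t};\xi^{k,t}),\qquad x^{k+1}=x^k-\eta_k\frac{m^k}{\|m^k\|},$$ where $m^k/\|m^k\|$ is read as $0$ if $m^k=0$. Here each sample $\xi^{k,t}$ has distribution $P$,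 and the tuples $(\xi^{k,t})_{1\le t\le p-1}$, $k\ge0$, are independent of each other; within one iteration the samples may depend on each other in any way (in particular they may be one shared sample, $\xi^{k,t}=\xi^k$, or $p-1$ independent samples). Define $$\widetilde M_{p,\alpha}=4\Big(f(x^0)-f_{\mathrm{low}}+4^{1/3}\sigma^\alpha+\frac{L_1}2+\frac{306\,p^{2p\alpha}L_p^\alpha}{(p!)^\alpha}\Big),$$ $$\widehat M_{p,\alpha}=8\Big(30^{1/(\alpha-1)}(\alpha-1)(2/\alpha)^{\alpha/(\alpha-1)}+64(p-1)^\alpha\sigma^\alpha\Big).$$ For any $\epsilon\in(0,1)$, put $$A=\frac{4(3p+1)\widetilde M_{p,\alpha}}{p\,\epsilon},\qquad B=\frac{2(3p\alpha+\alpha)\widehat M_{p,\alpha}}{p(\alpha-1)\,\epsilon}.$$ Then $\mathbb E[\|\nabla f(x^{\iota_K})\|]\le\epsilon$ for every integer $$K\ge\max\Big\{(A\ln A)^{(3p+1)/p},\ (B\ln B)^{(3p\alpha+\alpha)/(2p(\alpha-1))},\ 5\Big\},$$ where $\iota_K$ is uniformly drawn from $\{0,\dots,K-1\}$, independently of the samples.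 (If $A<1$ or $B<1$, so that the corresponding power has a negative base, the claim holds with that term omitted.) -/

import Mathlib

open MeasureTheory ProbabilityTheory

noncomputable section

namespace NSFOM

/-- `n`-dimensional Euclidean space. -/
abbrev Eucl (n : ℕ) : Type := EuclideanSpace ℝ (Fin n)

/-! ### The algorithm: normalized SFOM with multi-extrapolated momentum -/

section Algorithm

variable {n : ℕ} {Ξ : Type*}

/-- What the method remembers when iteration `k` begins: `x^{k-1}`, `x^k` and `m^{k-1}`. -/
structure State (n : ℕ) where
  /-- the previous iterate `x^{k-1}` -/
  xPrev : Eucl n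
  /-- the current iterate `x^k` -/
  x : Eucl n
  /-- the previous search direction `m^{k-1}` -/
  mPrev : Eucl n

/-- `prevGamma γ k t` is `γ_{k-1,t}`, with the initialization `γ_{-1,t} = 1`. -/
def prevGamma (γ : ℕ → ℕ → ℝ) : ℕ → ℕ → ℝ
  | 0, _ => 1
  | k + 1, t => γ k t

/-- `prevTheta q θ k t` is `θ_{k-1,t}`, with the initialization `θ_{-1,t} = 1 / q`. -/
def prevTheta (q : ℕ) (θ : ℕ → ℕ → ℝ) : ℕ → ℕ → ℝ
  | 0, _ => 1 / (q : ℝ)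
  | k + 1, t => θ k t

/-- The extrapolated point `z^{k,t} = x^k + ((1 - γ_{k-1,t}) / γ_{k-1,t}) (x^k - x^{k-1})`. -/
def extrapolate (γ : ℕ → ℕ → ℝ) (k t : ℕ) (S : State n) : Eucl n :=
  S.x + ((1 - prevGamma γ k t) / prevGamma γ k t) • (S.x - S.xPrev)

/-- The search direction
`m^k = (1 - ∑_t θ_{k-1,t}) m^{k-1} + ∑_t θ_{k-1,t} G(z^{k,t}; s_t)`, `1 ≤ t ≤ q`,
where `s_t` is the sample used for the `t`-th stochastic gradient of the iteration. -/
def direction (G : Eucl n → Ξ → Eucl n) (q : ℕ) (γ θ : ℕ → ℕ → ℝ) (k : ℕ) (S : State n)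
    (s : ℕ → Ξ) : Eucl n :=
  (1 - ∑ t ∈ Finset.Icc 1 q, prevTheta q θ k t) • S.mPrev +
    ∑ t ∈ Finset.Icc 1 q, prevTheta q θ k t • G (extrapolate γ k t S) (s t)

/-- The state of the method at the beginning of iteration `k`, for the samples
`s k t`, `1 ≤ t ≤ q`. It starts from `x^{-1} = x^0`, `m^{-1} = 0`, and updates
`x^{k+1} = x^k - η_k m^k / ‖m^k‖` (no move is made if `m^k = 0`). -/
def state (G : Eucl n → Ξ → Eucl n) (x₀ : Eucl n) (q : ℕ) (η : ℕ → ℝ) (γ θ : ℕ → ℕ → ℝ)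
    (s : ℕ → ℕ → Ξ) : ℕ → State n
  | 0 => ⟨x₀, x₀, 0⟩
  | k + 1 =>
    let S := state G x₀ q η γ θ s k
    let m := direction G q γ θ k S (s k)
    ⟨S.x, S.x - η k • (‖m‖⁻¹ • m), m⟩

/-- The iterate `x^k`. -/
def iterate (G : Eucl n → Ξ → Eucl n) (x₀ : Eucl n) (q : ℕ) (η : ℕ → ℝ) (γ θ : ℕ → ℕ → ℝ)
    (s : ℕ → ℕ → Ξ) (k : ℕ) : Eucl n :=
  (state G x₀ q η γ θ s k).x

end Algorithm

/-! ### The input parameters (none of them depends on the tail exponent) -/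

/-- Step sizes `η_k = 1 / (k+4)^{(2p+1)/(3p+1)}`. -/
def eta (p k : ℕ) : ℝ :=
  1 / ((k : ℝ) + 4) ^ ((2 * (p : ℝ) + 1) / (3 * (p : ℝ) + 1))

/-- `γ_k = 1 / (k+4)^{2p/(3p+1)}`. -/
def gamma (p k : ℕ) : ℝ :=
  1 / ((k : ℝ) + 4) ^ ((2 * (p : ℝ)) / (3 * (p : ℝ) + 1))

/-- Extrapolation parameters `γ_{k,t} = γ_k / t²`. -/
def gammaT (p k t : ℕ) : ℝ := gamma p k / (t : ℝ) ^ 2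

/-- Weighting parameters `θ_{k,t}`; the products are over `1 ≤ s ≤ p - 1`, `s ≠ t`. -/
def theta (p k t : ℕ) : ℝ :=
  (∏ s ∈ (Finset.Icc 1 (p - 1)).erase t, (1 - (s : ℝ) ^ 2 / gamma p k)) /
    (((t : ℝ) ^ 2 / gamma p k) *
      ∏ s ∈ (Finset.Icc 1 (p - 1)).erase t, (((t : ℝ) ^ 2 - (s : ℝ) ^ 2) / gamma p k))

/-! ### The assumptions -/

/-- The basic assumption: `f` is continuously differentiable and bounded below by `flow`, its
gradient is `L₁`-Lipschitz, and `G(·; ξ)`, `ξ ∼ P`, is an unbiased estimator of the gradient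
whose `α`-th central moment is at most `σ ^ α`. -/
structure BasicAssumption {n : ℕ} {Ξ : Type*} [MeasurableSpace Ξ] (P : Measure Ξ)
    (f : Eucl n → ℝ) (G : Eucl n → Ξ → Eucl n) (flow L₁ σ α : ℝ) : Prop where
  contDiff : ContDiff ℝ 1 f
  lower_bound : ∀ x, flow ≤ f x
  L₁_pos : 0 < L₁
  lipschitz_gradient : ∀ x y, ‖gradient f x - gradient f y‖ ≤ L₁ * ‖x - y‖
  σ_pos : 0 < σ
  one_lt_α : 1 < α
  α_le_two : α ≤ 2
  measurable_G : Measurable (fun y : Eucl n × Ξ => G y.1 y.2)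
  integrable_G : ∀ x, Integrable (fun s => G x s) P
  unbiased : ∀ x, ∫ s, G x s ∂P = gradient f x
  integrable_moment : ∀ x, Integrable (fun s => ‖G x s - gradient f x‖ ^ α) P
  moment_le : ∀ x, ∫ s, ‖G x s - gradient f x‖ ^ α ∂P ≤ σ ^ α

/-- High-order smoothness: `f` is `p` times continuously differentiable, `p ≥ 2`, and its `p`-th
derivative (a `p`-linear form with the operator norm) is `Lp`-Lipschitz. -/
structure HighSmoothAssumption {n : ℕ} (f : Eucl n → ℝ) (p : ℕ) (Lp : ℝ) : Prop where
  two_le_p : 2 ≤ p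
  contDiff : ContDiff ℝ p f
  Lp_pos : 0 < Lp
  lipschitz : ∀ x y, ‖iteratedFDeriv ℝ p f x - iteratedFDeriv ℝ p f y‖ ≤ Lp * ‖x - y‖

/-- The random samples `ξ k t`, `1 ≤ t ≤ q`, of iteration `k`: each has law `P`, and the tuples
`(ξ k t)_{1 ≤ t ≤ q}` drawn at different iterations `k` are independent. How the samples of one
and the same iteration depend on each other is left free: they may be one shared sample
(`ξ k t = ξ k`) or `q` independent ones. -/
structure IsSampling {Ω Ξ : Type*} [MeasurableSpace Ω] [MeasurableSpace Ξ] (μ : Measure Ω)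
    (P : Measure Ξ) (q : ℕ) (ξ : ℕ → ℕ → Ω → Ξ) : Prop where
  measurable : ∀ k, ∀ t ∈ Finset.Icc 1 q, Measurable (ξ k t)
  law : ∀ k, ∀ t ∈ Finset.Icc 1 q, μ.map (ξ k t) = P
  indep : iIndepFun (fun (k : ℕ) (ω : Ω) (t : Finset.Icc 1 q) => ξ k t ω) μ

/-- `ι` is uniformly drawn from `{0, …, K-1}`, independently of all the samples. -/
structure IsUniformIndex {Ω Ξ : Type*} [MeasurableSpace Ω] [MeasurableSpace Ξ] (μ : Measure Ω)
    (q : ℕ) (ξ : ℕ → ℕ → Ω → Ξ) (K : ℕ) (ι : Ω → ℕ) : Prop where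
  measurable : Measurable ι
  law : μ.map ι = uniformOn (Finset.range K : Set ℕ)
  indep : IndepFun ι (fun (ω : Ω) (k : ℕ) (t : Finset.Icc 1 q) => ξ k t ω) μ

/-! ### The constants and the iteration threshold -/

/-- `M̃_{p,α}`, where `gap` stands for `f(x^0) - flow`. -/
def Mtilde (p : ℕ) (α gap L₁ σ Lp : ℝ) : ℝ :=
  4 * (gap + (4 : ℝ) ^ ((1 : ℝ) / 3) * σ ^ α + L₁ / 2 +
    306 * (p : ℝ) ^ (2 * (p : ℝ) * α) * Lp ^ α / (p.factorial : ℝ) ^ α)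

/-- `M̂_{p,α}`. -/
def Mhat (p : ℕ) (α σ : ℝ) : ℝ :=
  8 * ((30 : ℝ) ^ (1 / (α - 1)) * (α - 1) * (2 / α) ^ (α / (α - 1)) +
    64 * ((p : ℝ) - 1) ^ α * σ ^ α)

/-- The number of iterations that suffices:
`max {(A ln A)^{(3p+1)/p}, (B ln B)^{(3pα+α)/(2p(α-1))}, 5}` with
`A = 4(3p+1)M̃/(pε)` and `B = 2(3pα+α)M̂/(p(α-1)ε)`. -/
def threshold (p : ℕ) (α gap L₁ σ Lp ε : ℝ) : ℝ :=
  let A := 4 * (3 * (p : ℝ) + 1) * Mtilde p α gap L₁ σ Lp / ((p : ℝ) * ε)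
  let B := 2 * (3 * (p : ℝ) * α + α) * Mhat p α σ / ((p : ℝ) * (α - 1) * ε)
  max ((A * Real.log A) ^ ((3 * (p : ℝ) + 1) / (p : ℝ)))
    (max ((B * Real.log B) ^ ((3 * (p : ℝ) * α + α) / (2 * (p : ℝ) * (α - 1)))) 5)

end NSFOM

end

/-!
The proof follows a potential function along the run. Write `e_k = m^k - ∇f(x^k)`.

*Bias.* The weights `θ_{k,t}` are the Lagrange coefficients at `1` for the nodes `0` and `t² / γ_k`,
`1 ≤ t ≤ p - 1`, the node `0` having the coefficient `1 - ∑ θ_{k,t} = ∏ (1 - γ_k / t²)`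
(`sum_weight_mul_pow`). Since `z^{k+1,t} = x^k + (t² / γ_k) (x^{k+1} - x^k)`, all Taylor terms of the
gradient at `x^k` up to order `p - 1` cancel in the expected update of `m^k`. The remainder is of
order `η_k^p γ_k^{1-p}` (`norm_bias_le`), because `|θ_{k,t}| ≤ 2 γ_k / t²` (`abs_weight_le`).

*Noise.* The linear term in the expansion of `‖a + v‖ ^ α` (`norm_add_rpow_le`) averages out when `v`
is fresh noise and `a` is determined by earlier samples (`moment_add_noise_le`). Together with the
bias this gives the recursion
`E‖e_{k+1}‖^α ≤ (1 - γ_k) E‖e_k‖^α + γ_k^{1-α} (bias)^α + O(γ_k^α σ^α)` (`moment_err_succ`).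

*Potential.* The function value decreases by `η_k ‖∇f(x^k)‖ - 2 η_k ‖e_k‖` up to `O(η_k²)`
(`descent_step`), and Young's inequality turns `2 η_k ‖e_k‖` into a small multiple of
`w_k γ_k ‖e_k‖^α`, which the factor `1 - γ_k` in the recursion absorbs. With the weight
`w_k = (k+4)^a`, `a = (2p(α-1)²/α - 1) / (3p+1)`, the noise and the remainder in Young's inequality
are both exactly of order `(k+4)^{-1+δ}`, `δ = p(2-α) / (α(3p+1))`, and the other terms are at most
of order `1 / (k+4)` (`potential_step`). Summation yields the rate
`K^{-p/(3p+1)} + K^{-2p(α-1)/((3p+1)α)}`, up to `ln K` (`average_gradient_le`).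

*Threshold.* `y ≥ A ln A` implies `y ≥ (A/2) ln y` for all positive `A` and `y`
(`half_mul_log_le`), which removes the logarithm; no lower bound on `A` is needed.
-/

namespace NSFOM

/-! ### The extrapolation weights -/

/-- The weight `θ` attached to the node `t ^ 2 / g` by Lagrange interpolation at the nodes
`0, 1 / g, 4 / g, …, q ^ 2 / g`, evaluated at `1`; thus `theta p k` is `weight (p - 1) (gamma p k)`. -/
noncomputable def weight (q : ℕ) (g : ℝ) (t : ℕ) : ℝ :=
  (∏ s ∈ (Finset.Icc 1 q).erase t, (1 - (s : ℝ) ^ 2 / g)) /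
    (((t : ℝ) ^ 2 / g) * ∏ s ∈ (Finset.Icc 1 q).erase t, (((t : ℝ) ^ 2 - (s : ℝ) ^ 2) / g))

lemma theta_eq_weight (p k t : ℕ) : theta p k t = weight (p - 1) (gamma p k) t := rfl

lemma injOn_nodes {g : ℝ} (hg : 0 < g) (S : Set ℕ) :
    Set.InjOn (fun t : ℕ => (t : ℝ) ^ 2 / g) S := by
  intro a _ b _ h
  have h' : (a : ℝ) ^ 2 = (b : ℝ) ^ 2 := by
    have := congrArg (· * g) h
    simpa [div_mul_cancel₀ _ hg.ne'] using this
  have := (sq_eq_sq₀ (Nat.cast_nonneg a) (Nat.cast_nonneg b)).1 h'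
  exact_mod_cast this

lemma range_succ_eq_insert_Icc (q : ℕ) : Finset.range (q + 1) = insert 0 (Finset.Icc 1 q) := by
  ext s; simp only [Finset.mem_range, Finset.mem_insert, Finset.mem_Icc]; omega

lemma eval_basis_eq_weight {q : ℕ} {g : ℝ} {t : ℕ} (ht : t ∈ Finset.Icc 1 q) :
    (Lagrange.basis (Finset.range (q + 1)) (fun t : ℕ => (t : ℝ) ^ 2 / g) t).eval 1
      = weight q g t := by
  have ht1 : 1 ≤ t := (Finset.mem_Icc.1 ht).1
  have h0 : (Finset.range (q + 1)).erase t = insert 0 ((Finset.Icc 1 q).erase t) := by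
    rw [range_succ_eq_insert_Icc, Finset.erase_insert_of_ne (by omega)]
  rw [Lagrange.basis, Polynomial.eval_prod, h0, Finset.prod_insert (by simp), weight]
  simp only [Lagrange.basisDivisor, Polynomial.eval_mul, Polynomial.eval_C, Polynomial.eval_sub,
    Polynomial.eval_X, Finset.prod_mul_distrib, Finset.prod_inv_distrib, sub_div]
  generalize (t : ℝ) ^ 2 / g = c
  rw [div_eq_mul_inv _ (c * _), mul_inv]
  simp
  ring

lemma eval_basis_zero {q : ℕ} {g : ℝ} (hg : 0 < g) :
    (Lagrange.basis (Finset.range (q + 1)) (fun t : ℕ => (t : ℝ) ^ 2 / g) 0).eval 1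
      = ∏ t ∈ Finset.Icc 1 q, (1 - g / (t : ℝ) ^ 2) := by
  have h0 : (Finset.range (q + 1)).erase 0 = Finset.Icc 1 q := by
    rw [range_succ_eq_insert_Icc, Finset.erase_insert (by simp)]
  rw [Lagrange.basis, Polynomial.eval_prod, h0]
  refine Finset.prod_congr rfl fun t ht => ?_
  have ht1 : (0 : ℝ) < t := by exact_mod_cast (Finset.mem_Icc.1 ht).1
  simp only [Lagrange.basisDivisor, Polynomial.eval_mul, Polynomial.eval_C, Polynomial.eval_sub,
    Polynomial.eval_X]
  field_simp
  push_cast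
  ring

/-- Interpolation at `1` reproduces the monomials of degree at most `q`. -/
lemma sum_weight_mul_pow {q : ℕ} {g : ℝ} (hg : 0 < g) {j : ℕ} (hj : j ≤ q) :
    (0 : ℝ) ^ j * ∏ t ∈ Finset.Icc 1 q, (1 - g / (t : ℝ) ^ 2) +
      ∑ t ∈ Finset.Icc 1 q, weight q g t * ((t : ℝ) ^ 2 / g) ^ j = 1 := by
  have h := Lagrange.eq_interpolate (s := Finset.range (q + 1))
    (v := fun t : ℕ => (t : ℝ) ^ 2 / g) (f := (Polynomial.X : Polynomial ℝ) ^ j)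
    (injOn_nodes hg _) (by
      rw [Polynomial.degree_X_pow, Finset.card_range]; exact_mod_cast Nat.lt_succ_of_le hj)
  have h1 := congrArg (Polynomial.eval 1) h
  rw [Lagrange.interpolate_apply, Polynomial.eval_finsetSum, range_succ_eq_insert_Icc,
    Finset.sum_insert (by simp), ← range_succ_eq_insert_Icc] at h1
  simp only [Polynomial.eval_mul, Polynomial.eval_C, Polynomial.eval_pow, Polynomial.eval_X,
    one_pow, eval_basis_zero hg] at h1
  refine Eq.trans ?_ h1.symm
  congr 1
  · simp
  · refine Finset.sum_congr rfl fun t ht => ?_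
    rw [eval_basis_eq_weight ht, mul_comm]

lemma sum_weight_mul_node_pow {q : ℕ} {g : ℝ} (hg : 0 < g) {j : ℕ} (hj1 : 1 ≤ j) (hj : j ≤ q) :
    ∑ t ∈ Finset.Icc 1 q, weight q g t * ((t : ℝ) ^ 2 / g) ^ j = 1 := by
  have := sum_weight_mul_pow hg hj
  rwa [zero_pow (by omega), zero_mul, zero_add] at this

/-- The momentum coefficient is the weight of the node `0`. -/
lemma one_sub_sum_weight {q : ℕ} {g : ℝ} (hg : 0 < g) :
    1 - ∑ t ∈ Finset.Icc 1 q, weight q g t = ∏ t ∈ Finset.Icc 1 q, (1 - g / (t : ℝ) ^ 2) := by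
  have := sum_weight_mul_pow hg (Nat.zero_le q)
  simp only [pow_zero, one_mul, mul_one] at this
  linarith

lemma one_sub_div_sq_mem {g : ℝ} (hg : 0 < g) (hg1 : g ≤ 1) {t : ℕ} (ht : 1 ≤ t) :
    0 ≤ 1 - g / (t : ℝ) ^ 2 ∧ 1 - g / (t : ℝ) ^ 2 ≤ 1 := by
  have h1 : (1 : ℝ) ≤ (t : ℝ) ^ 2 := one_le_pow₀ (by exact_mod_cast ht)
  have h2 : g / (t : ℝ) ^ 2 ≤ 1 := (div_le_one (by linarith)).2 (by linarith)
  have h3 : 0 ≤ g / (t : ℝ) ^ 2 := by positivity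
  constructor <;> linarith

lemma one_sub_sum_weight_nonneg {q : ℕ} {g : ℝ} (hg : 0 < g) (hg1 : g ≤ 1) :
    0 ≤ 1 - ∑ t ∈ Finset.Icc 1 q, weight q g t := by
  rw [one_sub_sum_weight hg]
  exact Finset.prod_nonneg fun t ht => (one_sub_div_sq_mem hg hg1 (Finset.mem_Icc.1 ht).1).1

lemma le_sum_weight {q : ℕ} (hq : 1 ≤ q) {g : ℝ} (hg : 0 < g) (hg1 : g ≤ 1) :
    g ≤ ∑ t ∈ Finset.Icc 1 q, weight q g t := by
  have h : ∏ t ∈ Finset.Icc 1 q, (1 - g / (t : ℝ) ^ 2) ≤ 1 - g := by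
    rw [← Finset.mul_prod_erase _ _ (Finset.mem_Icc.2 ⟨le_rfl, hq⟩)]
    have h1 : ∏ t ∈ (Finset.Icc 1 q).erase 1, (1 - g / (t : ℝ) ^ 2) ≤ 1 :=
      Finset.prod_le_one
        (fun t ht => (one_sub_div_sq_mem hg hg1 (Finset.mem_Icc.1 (Finset.mem_of_mem_erase ht)).1).1)
        (fun t ht => (one_sub_div_sq_mem hg hg1 (Finset.mem_Icc.1 (Finset.mem_of_mem_erase ht)).1).2)
    have h2 : (0 : ℝ) ≤ 1 - g := by linarith
    simpa using mul_le_mul_of_nonneg_left h1 h2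
  have := one_sub_sum_weight (q := q) hg
  linarith

/-- The product of `s ^ 2 / |t ^ 2 - s ^ 2|` over `1 ≤ s ≤ t + d`, `s ≠ t`, in closed form. -/
lemma prod_sq_div_abs_sub_eq (t d : ℕ) (ht : 1 ≤ t) :
    ∏ s ∈ (Finset.Icc 1 (t + d)).erase t, ((s : ℝ) ^ 2 / |(t : ℝ) ^ 2 - (s : ℝ) ^ 2|)
      = 2 * ((t + d).factorial : ℝ) ^ 2 / (d.factorial * (2 * t + d).factorial) := by
  induction d with
  | zero =>
    obtain ⟨m, rfl⟩ : ∃ m, t = m + 1 := ⟨t - 1, by omega⟩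
    have hset : (Finset.Icc 1 (m + 1 + 0)).erase (m + 1) = (Finset.range m).image (· + 1) := by
      ext s
      simp only [Finset.mem_erase, Finset.mem_Icc, Finset.mem_image, Finset.mem_range]
      constructor
      · rintro ⟨h1, h2, h3⟩; exact ⟨s - 1, by omega, by omega⟩
      · rintro ⟨a, h1, rfl⟩; omega
    rw [hset, Finset.prod_image (by intro a _ b _ h; simpa using h)]
    have hterm : ∀ i ∈ Finset.range m,
        (((i + 1 : ℕ) : ℝ) ^ 2 / |((m + 1 : ℕ) : ℝ) ^ 2 - ((i + 1 : ℕ) : ℝ) ^ 2|)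
          = ((i + 1 : ℕ) : ℝ) ^ 2 * (((m - 1 - i + 1 : ℕ) : ℝ) * ((m + 1 + 1 + i : ℕ) : ℝ))⁻¹ := by
      intro i hi
      have him := Finset.mem_range.1 hi
      have e : ((m - 1 - i + 1 : ℕ) : ℝ) = m - i := by
        rw [show m - 1 - i + 1 = m - i by omega, Nat.cast_sub him.le]
      have him' : (i : ℝ) < m := by exact_mod_cast him
      rw [e, div_eq_mul_inv]
      congr 2
      rw [abs_of_nonneg]
      · push_cast; ring
      · push_cast; nlinarith
    rw [Finset.prod_congr rfl hterm, Finset.prod_mul_distrib, Finset.prod_inv_distrib,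
      Finset.prod_mul_distrib, Finset.prod_range_reflect (fun j => ((j + 1 : ℕ) : ℝ)) m,
      Finset.prod_pow]
    have e1 : ∏ i ∈ Finset.range m, ((i + 1 : ℕ) : ℝ) = m.factorial := by
      rw [← Nat.cast_prod, Finset.prod_range_add_one_eq_factorial]
    have e2 : ((m + 1).factorial : ℝ) * ∏ i ∈ Finset.range m, ((m + 1 + 1 + i : ℕ) : ℝ)
        = (2 * m + 1).factorial := by
      rw [← Nat.cast_prod, ← Nat.ascFactorial_eq_prod_range, ← Nat.cast_mul,
        Nat.factorial_mul_ascFactorial]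
      congr 2; ring
    have hm : (m.factorial : ℝ) ≠ 0 := by positivity
    have hm1 : ((m + 1).factorial : ℝ) ≠ 0 := by positivity
    have e3 : ∏ i ∈ Finset.range m, ((m + 1 + 1 + i : ℕ) : ℝ)
        = (2 * m + 1).factorial / (m + 1).factorial := by
      rw [← e2]; field_simp
    rw [e1, e3]
    have h2m : ((2 * (m + 1) + 0).factorial : ℝ) = (2 * m + 2) * (2 * m + 1).factorial := by
      rw [show 2 * (m + 1) + 0 = (2 * m + 1) + 1 by ring, Nat.factorial_succ]; push_cast; ring
    have hf : ((2 * m + 1).factorial : ℝ) ≠ 0 := by positivity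
    have hms : ((m + 1 + 0).factorial : ℝ) = (m + 1) * m.factorial := by
      rw [add_zero, Nat.factorial_succ]; push_cast; ring
    rw [h2m, add_zero]
    rw [add_zero] at hms
    rw [hms, Nat.factorial_zero]
    field_simp
    push_cast
    ring
  | succ d ih =>
    have hset : (Finset.Icc 1 (t + (d + 1))).erase t
        = insert (t + d + 1) ((Finset.Icc 1 (t + d)).erase t) := by
      ext s
      simp only [Finset.mem_erase, Finset.mem_Icc, Finset.mem_insert]
      omega
    rw [hset, Finset.prod_insert (by simp), ih]
    have habs : |(t : ℝ) ^ 2 - ((t + d + 1 : ℕ) : ℝ) ^ 2| = (d + 1) * (2 * t + d + 1) := by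
      have h : (t : ℝ) ^ 2 - ((t + d + 1 : ℕ) : ℝ) ^ 2 = -((d + 1) * (2 * t + d + 1)) := by
        push_cast; ring
      rw [h, abs_neg, abs_of_nonneg (by positivity)]
    rw [habs]
    have f1 : ((t + (d + 1)).factorial : ℝ) = (t + d + 1) * (t + d).factorial := by
      rw [← add_assoc, Nat.factorial_succ]; push_cast; ring
    have f2 : ((d + 1).factorial : ℝ) = (d + 1) * d.factorial := by
      rw [Nat.factorial_succ]; push_cast; ring
    have f3 : ((2 * t + (d + 1)).factorial : ℝ) = (2 * t + d + 1) * (2 * t + d).factorial := by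
      rw [← add_assoc, Nat.factorial_succ]; push_cast; ring
    rw [f1, f2, f3]
    have g1 : (d.factorial : ℝ) ≠ 0 := by positivity
    have g2 : ((2 * t + d).factorial : ℝ) ≠ 0 := by positivity
    field_simp
    push_cast
    ring

lemma factorial_sq_le (t d : ℕ) :
    (t + d).factorial ^ 2 ≤ d.factorial * (2 * t + d).factorial := by
  have h1 : d.factorial * (d + 1).ascFactorial t = (d + t).factorial :=
    Nat.factorial_mul_ascFactorial d t
  have h2 : (t + d).factorial * (t + d + 1).ascFactorial t = (t + d + t).factorial :=
    Nat.factorial_mul_ascFactorial (t + d) t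
  have h3 : (d + 1).ascFactorial t ≤ (t + d + 1).ascFactorial t := by
    rw [Nat.ascFactorial_eq_prod_range, Nat.ascFactorial_eq_prod_range]
    exact Finset.prod_le_prod' fun i _ => by omega
  rw [show 2 * t + d = t + d + t by ring, ← h2, sq]
  calc (t + d).factorial * (t + d).factorial
      = (t + d).factorial * (d.factorial * (d + 1).ascFactorial t) := by
        rw [h1, add_comm d t]
    _ ≤ (t + d).factorial * (d.factorial * (t + d + 1).ascFactorial t) := by gcongr
    _ = _ := by ring

lemma prod_sq_div_abs_sub_le {q t : ℕ} (ht : t ∈ Finset.Icc 1 q) :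
    ∏ s ∈ (Finset.Icc 1 q).erase t, ((s : ℝ) ^ 2 / |(t : ℝ) ^ 2 - (s : ℝ) ^ 2|) ≤ 2 := by
  obtain ⟨h1, h2⟩ := Finset.mem_Icc.1 ht
  obtain ⟨d, rfl⟩ := Nat.exists_eq_add_of_le h2
  rw [prod_sq_div_abs_sub_eq t d h1, div_le_iff₀ (by positivity)]
  have := factorial_sq_le t d
  have h : ((t + d).factorial : ℝ) ^ 2 ≤ d.factorial * (2 * t + d).factorial := by
    exact_mod_cast this
  linarith

/-- The weights are of order `g`, uniformly in the number of nodes. -/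
lemma abs_weight_le {q t : ℕ} (ht : t ∈ Finset.Icc 1 q) {g : ℝ} (hg : 0 < g) (hg1 : g ≤ 1) :
    |weight q g t| ≤ 2 * g / (t : ℝ) ^ 2 := by
  have ht1 : (0 : ℝ) < t := by exact_mod_cast (Finset.mem_Icc.1 ht).1
  have hprod : |∏ s ∈ (Finset.Icc 1 q).erase t, (1 - (s : ℝ) ^ 2 / g)| /
      |∏ s ∈ (Finset.Icc 1 q).erase t, (((t : ℝ) ^ 2 - (s : ℝ) ^ 2) / g)| ≤ 2 := by
    rw [Finset.abs_prod, Finset.abs_prod, ← Finset.prod_div_distrib]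
    refine (Finset.prod_le_prod (fun s _ => by positivity) fun s hs => ?_).trans
      (prod_sq_div_abs_sub_le ht)
    have hs1 : (1 : ℝ) ≤ (s : ℝ) ^ 2 :=
      one_le_pow₀ (by exact_mod_cast (Finset.mem_Icc.1 (Finset.mem_of_mem_erase hs)).1)
    have e1 : |1 - (s : ℝ) ^ 2 / g| = ((s : ℝ) ^ 2 - g) / g := by
      rw [abs_sub_comm, abs_of_nonneg]
      · field_simp
      · rw [sub_nonneg, one_le_div hg]; linarith
    rw [e1, abs_div, abs_of_pos hg, div_div_div_cancel_right₀ hg.ne']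
    gcongr
    linarith
  have e : |weight q g t| = (g / (t : ℝ) ^ 2) *
      (|∏ s ∈ (Finset.Icc 1 q).erase t, (1 - (s : ℝ) ^ 2 / g)| /
      |∏ s ∈ (Finset.Icc 1 q).erase t, (((t : ℝ) ^ 2 - (s : ℝ) ^ 2) / g)|) := by
    rw [weight, abs_div, abs_mul, abs_of_pos (show (0 : ℝ) < (t : ℝ) ^ 2 / g by positivity)]
    field_simp
  rw [e]
  calc _ ≤ (g / (t : ℝ) ^ 2) * 2 := by gcongr
    _ = _ := by ring

lemma sum_abs_weight_le {q : ℕ} {g : ℝ} (hg : 0 < g) (hg1 : g ≤ 1) :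
    ∑ t ∈ Finset.Icc 1 q, |weight q g t| ≤ 2 * q * g := by
  calc ∑ t ∈ Finset.Icc 1 q, |weight q g t| ≤ ∑ _t ∈ Finset.Icc 1 q, 2 * g := by
        refine Finset.sum_le_sum fun t ht => (abs_weight_le ht hg hg1).trans ?_
        exact div_le_self (by positivity) (one_le_pow₀ (by exact_mod_cast (Finset.mem_Icc.1 ht).1))
    _ = 2 * q * g := by simp; ring

/-- The factor that multiplies the Taylor remainder in the bias of the extrapolated gradient. -/
lemma one_add_sum_abs_weight_mul_node_pow_le {p : ℕ} (hp : 2 ≤ p) {g : ℝ} (hg : 0 < g)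
    (hg1 : g ≤ 1) :
    1 + ∑ t ∈ Finset.Icc 1 (p - 1), |weight (p - 1) g t| * ((t : ℝ) ^ 2 / g) ^ p
      ≤ 3 * (p : ℝ) ^ (2 * p) * (g ^ (p - 1))⁻¹ := by
  obtain ⟨m, rfl⟩ : ∃ m, p = m + 1 := ⟨p - 1, by omega⟩
  simp only [Nat.add_sub_cancel]
  have hp1 : (1 : ℝ) ≤ ((m + 1 : ℕ) : ℝ) := by exact_mod_cast (by omega : 1 ≤ m + 1)
  have hterm : ∀ t ∈ Finset.Icc 1 m, |weight m g t| * ((t : ℝ) ^ 2 / g) ^ (m + 1)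
      ≤ 2 * ((m + 1 : ℕ) : ℝ) ^ (2 * m) * (g ^ m)⁻¹ := by
    intro t ht
    have ht1 : (0 : ℝ) < t := by exact_mod_cast (Finset.mem_Icc.1 ht).1
    have ht2 : (t : ℝ) ≤ ((m + 1 : ℕ) : ℝ) := by
      exact_mod_cast (Finset.mem_Icc.1 ht).2.trans (Nat.le_succ m)
    calc |weight m g t| * ((t : ℝ) ^ 2 / g) ^ (m + 1)
        ≤ (2 * g / (t : ℝ) ^ 2) * ((t : ℝ) ^ 2 / g) ^ (m + 1) := by
          gcongr; exact abs_weight_le ht hg hg1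
      _ = 2 * (t : ℝ) ^ (2 * m) * (g ^ m)⁻¹ := by
          rw [div_pow, pow_mul]; field_simp; ring
      _ ≤ _ := by gcongr
  have hginv : 1 ≤ (g ^ m)⁻¹ := (one_le_inv₀ (by positivity)).2 (pow_le_one₀ hg.le hg1)
  have hpow : (1 : ℝ) ≤ ((m + 1 : ℕ) : ℝ) ^ (2 * (m + 1)) := one_le_pow₀ hp1
  have hsum := Finset.sum_le_sum hterm
  rw [Finset.sum_const, Nat.card_Icc, nsmul_eq_mul, Nat.add_sub_cancel] at hsum
  have hm : (m : ℝ) * (2 * ((m + 1 : ℕ) : ℝ) ^ (2 * m) * (g ^ m)⁻¹)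
      ≤ 2 * ((m + 1 : ℕ) : ℝ) ^ (2 * (m + 1)) * (g ^ m)⁻¹ := by
    have h1 : (m : ℝ) ≤ ((m + 1 : ℕ) : ℝ) ^ 2 := by push_cast; nlinarith [Nat.cast_nonneg (α := ℝ) m]
    calc (m : ℝ) * (2 * ((m + 1 : ℕ) : ℝ) ^ (2 * m) * (g ^ m)⁻¹)
        ≤ ((m + 1 : ℕ) : ℝ) ^ 2 * (2 * ((m + 1 : ℕ) : ℝ) ^ (2 * m) * (g ^ m)⁻¹) := by gcongr
      _ = _ := by rw [show 2 * (m + 1) = 2 * m + 2 by ring, pow_add]; ring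
  have h1 : (1 : ℝ) ≤ ((m + 1 : ℕ) : ℝ) ^ (2 * (m + 1)) * (g ^ m)⁻¹ :=
    one_le_mul_of_one_le_of_one_le hpow hginv
  linarith

/-! ### Taylor expansion of the gradient along a line -/

section Taylor

variable {V : Type*} [NormedAddCommGroup V] [NormedSpace ℝ V]

/-- Taylor's formula on a half-line for a curve whose last derivative is Lipschitz at the origin.
No derivative beyond that one is needed, so the remainder carries the full factorial. -/
lemma norm_sub_taylor_le {m : ℕ} {g : ℝ → V} (hg : ContDiff ℝ m g) {L : ℝ}
    (hL : ∀ s, 0 ≤ s → ‖iteratedDeriv m g s - iteratedDeriv m g 0‖ ≤ L * s) {s : ℝ} (hs : 0 ≤ s) :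
    ‖g s - ∑ j ∈ Finset.range (m + 1), (s ^ j / (j.factorial : ℝ)) • iteratedDeriv j g 0‖
      ≤ L * s ^ (m + 1) / (m + 1).factorial := by
  induction m generalizing g s with
  | zero => simpa using hL s hs
  | succ m ih =>
    have hg' : ContDiff ℝ m (deriv g) := by
      have h : ContDiff ℝ ((m : WithTop ℕ∞) + 1) g := by exact_mod_cast hg
      exact (contDiff_succ_iff_deriv.1 h).2.2
    have hdiff : Differentiable ℝ g := hg.differentiable (by simp)
    have hbound : ∀ y, 0 ≤ y → ‖deriv g y -
        ∑ j ∈ Finset.range (m + 1), (y ^ j / (j.factorial : ℝ)) • iteratedDeriv (j + 1) g 0‖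
        ≤ L * y ^ (m + 1) / (m + 1).factorial := by
      intro y hy
      have := ih hg' (fun t ht => by simpa only [iteratedDeriv_succ'] using hL t ht) hy
      simpa only [iteratedDeriv_succ'] using this
    have hderiv : ∀ y, HasDerivAt (fun y => g y -
        ∑ j ∈ Finset.range (m + 1 + 1), (y ^ j / (j.factorial : ℝ)) • iteratedDeriv j g 0)
        (deriv g y -
          ∑ j ∈ Finset.range (m + 1), (y ^ j / (j.factorial : ℝ)) • iteratedDeriv (j + 1) g 0) y := by
      intro y
      refine (hdiff y).hasDerivAt.sub ?_
      simp_rw [Finset.sum_range_succ' _ (m + 1)]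
      simp only [pow_zero]
      refine HasDerivAt.add_const _ ?_
      refine HasDerivAt.fun_sum fun j _ => ?_
      refine HasDerivAt.smul_const ?_ _
      have h := (hasDerivAt_pow (j + 1) y).div_const ((j + 1).factorial : ℝ)
      convert h using 1
      rw [Nat.factorial_succ, Nat.add_sub_cancel]
      push_cast
      have : (j.factorial : ℝ) ≠ 0 := by positivity
      field_simp
    have hB : ∀ y : ℝ, HasDerivAt (fun y => L * y ^ (m + 1 + 1) / (m + 1 + 1).factorial)
        (L * y ^ (m + 1) / (m + 1).factorial) y := by
      intro y
      have h := ((hasDerivAt_pow (m + 1 + 1) y).const_mul L).div_const ((m + 1 + 1).factorial : ℝ)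
      have e : L * (((m + 1 + 1 : ℕ) : ℝ) * y ^ (m + 1 + 1 - 1)) / ((m + 1 + 1).factorial : ℝ)
          = L * y ^ (m + 1) / (m + 1).factorial := by
        rw [Nat.factorial_succ (m + 1), Nat.add_sub_cancel]
        push_cast
        have : ((m + 1).factorial : ℝ) ≠ 0 := by positivity
        field_simp
      exact e ▸ h
    refine image_norm_le_of_norm_deriv_right_le_deriv_boundary (a := 0) (b := s)
      (fun y _ => (hderiv y).continuousAt.continuousWithinAt)
      (fun y _ => (hderiv y).hasDerivWithinAt) ?_ hB (fun y hy => hbound y hy.1) ⟨hs, le_rfl⟩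
    simp [Finset.sum_range_succ']

/-- If the weights `θ` with nodes `u` reproduce polynomials of degree `m` at `1`, then the
extrapolation of `g` from `0` and the nodes to `1` is exact up to the Taylor remainders. -/
lemma norm_extrapolation_sub_le {m : ℕ} {g : ℝ → V} (hg : ContDiff ℝ m g) {L : ℝ}
    (hL : ∀ s, 0 ≤ s → ‖iteratedDeriv m g s - iteratedDeriv m g 0‖ ≤ L * s)
    (S : Finset ℕ) (θ u : ℕ → ℝ) (hu : ∀ t ∈ S, 0 ≤ u t)
    (hθ : ∀ j, 1 ≤ j → j ≤ m → ∑ t ∈ S, θ t * u t ^ j = 1) :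
    ‖(1 - ∑ t ∈ S, θ t) • g 0 + ∑ t ∈ S, θ t • g (u t) - g 1‖
      ≤ L / (m + 1).factorial * (1 + ∑ t ∈ S, |θ t| * u t ^ (m + 1)) := by
  set T : ℝ → V := fun s =>
    ∑ j ∈ Finset.range (m + 1), (s ^ j / (j.factorial : ℝ)) • iteratedDeriv j g 0 with hT
  have hrem : ∀ s, 0 ≤ s → ‖g s - T s‖ ≤ L * s ^ (m + 1) / (m + 1).factorial :=
    fun s hs => norm_sub_taylor_le hg hL hs
  have hT0 : T 0 = g 0 := by simp [hT, Finset.sum_range_succ']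
  have hcancel : (1 - ∑ t ∈ S, θ t) • T 0 + ∑ t ∈ S, θ t • T (u t) - T 1 = 0 := by
    simp only [hT, Finset.smul_sum, smul_smul]
    rw [Finset.sum_comm, ← Finset.sum_add_distrib, ← Finset.sum_sub_distrib]
    refine Finset.sum_eq_zero fun j hj => ?_
    rw [← Finset.sum_smul, ← add_smul, ← sub_smul]
    convert zero_smul ℝ _
    rcases Nat.eq_zero_or_pos j with rfl | hj0
    · simp
    · rw [zero_pow (by omega), one_pow, zero_div, mul_zero, zero_add]
      have := hθ j hj0 (by have := Finset.mem_range.1 hj; omega)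
      simp_rw [← mul_div_assoc]
      rw [← Finset.sum_div, this, sub_self]
  have hsplit : (1 - ∑ t ∈ S, θ t) • g 0 + ∑ t ∈ S, θ t • g (u t) - g 1
      = ∑ t ∈ S, θ t • (g (u t) - T (u t)) - (g 1 - T 1) := by
    have h : (1 - ∑ t ∈ S, θ t) • g 0 + ∑ t ∈ S, θ t • g (u t) - g 1
        = (∑ t ∈ S, θ t • (g (u t) - T (u t)) - (g 1 - T 1)) +
          ((1 - ∑ t ∈ S, θ t) • T 0 + ∑ t ∈ S, θ t • T (u t) - T 1) := by
      rw [hT0]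
      simp only [smul_sub, Finset.sum_sub_distrib]
      abel
    rw [h, hcancel, add_zero]
  rw [hsplit]
  calc ‖∑ t ∈ S, θ t • (g (u t) - T (u t)) - (g 1 - T 1)‖
      ≤ ∑ t ∈ S, |θ t| * (L * u t ^ (m + 1) / (m + 1).factorial) +
          L * 1 ^ (m + 1) / (m + 1).factorial := by
        refine (norm_sub_le _ _).trans (add_le_add ((norm_sum_le _ _).trans ?_) (hrem 1 zero_le_one))
        refine Finset.sum_le_sum fun t ht => ?_
        rw [norm_smul, Real.norm_eq_abs]
        exact mul_le_mul_of_nonneg_left (hrem _ (hu t ht)) (abs_nonneg _)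
    _ = _ := by
        rw [mul_add, Finset.mul_sum, one_pow, mul_one, mul_one, add_comm]
        congr 1
        exact Finset.sum_congr rfl fun t _ => by ring

end Taylor

section Gradient

variable {n : ℕ}

lemma iteratedDeriv_comp_line {W V : Type*} [NormedAddCommGroup W] [NormedSpace ℝ W]
    [NormedAddCommGroup V] [NormedSpace ℝ V] {m : ℕ} {F : W → V} (hF : ContDiff ℝ m F)
    (x d : W) (s : ℝ) :
    iteratedDeriv m (fun s : ℝ => F (x + s • d)) s
      = iteratedFDeriv ℝ m F (x + s • d) (fun _ => d) := by
  have h1 : (fun s : ℝ => F (x + s • d))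
      = (fun y => F (x + y)) ∘ (ContinuousLinearMap.toSpanSingleton ℝ d) := by
    ext s; simp
  have h2 : ContDiff ℝ m (fun y => F (x + y)) := hF.comp (contDiff_const.add contDiff_id)
  rw [iteratedDeriv_eq_iteratedFDeriv, h1, ContinuousLinearMap.iteratedFDeriv_comp_right _ h2 _ le_rfl,
    ContinuousMultilinearMap.compContinuousLinearMap_apply, iteratedFDeriv_comp_add_left]
  simp

/-- The bias of the extrapolated gradient: the weights remove all Taylor terms up to order `p - 1`
of the gradient at `x` in the direction `d`. -/
lemma norm_extrapolated_gradient_sub_le {f : Eucl n → ℝ} {p : ℕ} {Lp : ℝ}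
    (h : HighSmoothAssumption f p Lp) (S : Finset ℕ) (θ u : ℕ → ℝ) (hu : ∀ t ∈ S, 0 ≤ u t)
    (hθ : ∀ j, 1 ≤ j → j ≤ p - 1 → ∑ t ∈ S, θ t * u t ^ j = 1) (x d : Eucl n) :
    ‖(1 - ∑ t ∈ S, θ t) • gradient f x + ∑ t ∈ S, θ t • gradient f (x + u t • d)
        - gradient f (x + d)‖
      ≤ Lp * ‖d‖ ^ p / p.factorial * (1 + ∑ t ∈ S, |θ t| * u t ^ p) := by
  obtain ⟨m, rfl⟩ : ∃ m, p = m + 1 := ⟨p - 1, by have := h.two_le_p; omega⟩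
  have hF : ContDiff ℝ m (fderiv ℝ f) := h.contDiff.fderiv_right (by norm_cast)
  have hg : ContDiff ℝ m (fun s : ℝ => fderiv ℝ f (x + s • d)) := by
    refine hF.comp ?_
    fun_prop
  have hlip : ∀ y z, ‖iteratedFDeriv ℝ m (fderiv ℝ f) y - iteratedFDeriv ℝ m (fderiv ℝ f) z‖
      ≤ Lp * ‖y - z‖ := by
    intro y z
    have := h.lipschitz y z
    rw [iteratedFDeriv_succ_eq_comp_right, iteratedFDeriv_succ_eq_comp_right, Function.comp_apply,
      Function.comp_apply, ← dist_eq_norm] at this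
    exact (dist_eq_norm _ _).symm.le.trans
      (((continuousMultilinearCurryRightEquiv' ℝ m (Eucl n) ℝ).symm.dist_map _ _).symm.le.trans this)
  have hL : ∀ s : ℝ, 0 ≤ s → ‖iteratedDeriv m (fun s : ℝ => fderiv ℝ f (x + s • d)) s
      - iteratedDeriv m (fun s : ℝ => fderiv ℝ f (x + s • d)) 0‖ ≤ (Lp * ‖d‖ ^ (m + 1)) * s := by
    intro s hs
    rw [iteratedDeriv_comp_line hF, iteratedDeriv_comp_line hF, ← sub_apply]
    refine (ContinuousMultilinearMap.le_opNorm _ _).trans ?_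
    have h1 := hlip (x + s • d) (x + (0 : ℝ) • d)
    rw [zero_smul, add_zero, add_sub_cancel_left, norm_smul, Real.norm_of_nonneg hs] at h1
    rw [zero_smul, add_zero, Finset.prod_const, Finset.card_univ, Fintype.card_fin]
    calc _ ≤ Lp * (s * ‖d‖) * ‖d‖ ^ m := by gcongr
      _ = _ := by ring
  have key := norm_extrapolation_sub_le hg hL S θ u hu (by simpa using hθ)
  simp only [zero_smul, one_smul, add_zero] at key
  have e : (InnerProductSpace.toDual ℝ (Eucl n))
      ((1 - ∑ t ∈ S, θ t) • gradient f x + ∑ t ∈ S, θ t • gradient f (x + u t • d)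
        - gradient f (x + d))
      = (1 - ∑ t ∈ S, θ t) • fderiv ℝ f x + ∑ t ∈ S, θ t • fderiv ℝ f (x + u t • d)
        - fderiv ℝ f (x + d) := by
    simp only [map_sub, map_add, map_sum, map_smulₛₗ, toDual_gradient]
    simp
  rw [← (InnerProductSpace.toDual ℝ (Eucl n)).norm_map, e]
  exact key

end Gradient

/-! ### Inequalities for powers with exponent in `(1, 2]` -/

section Powers

/-- A von Bahr–Esseen type inequality: the first-order expansion of `‖x + v‖ ^ α`, with a remainder
of order `‖v‖ ^ α`. At `x = 0` the linear term vanishes whatever the junk value of `0 ^ (α - 2)`. -/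
lemma norm_add_rpow_le {E : Type*} [NormedAddCommGroup E] [InnerProductSpace ℝ E] {α : ℝ}
    (h1 : 1 < α) (h2 : α ≤ 2) (x v : E) :
    ‖x + v‖ ^ α ≤ ‖x‖ ^ α + α * ‖x‖ ^ (α - 2) * inner ℝ x v + 6 * ‖v‖ ^ α := by
  have hv0 := norm_nonneg v
  have hx0 := norm_nonneg x
  rcases eq_or_ne x 0 with rfl | hx
  · have : 0 ≤ ‖v‖ ^ α := by positivity
    simp only [zero_add, inner_zero_left, mul_zero, add_zero]
    rw [norm_zero, Real.zero_rpow (by linarith)]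
    linarith
  have hxpos : 0 < ‖x‖ := norm_pos_iff.2 hx
  have hr2 : ‖x‖ ^ α = ‖x‖ ^ (α - 2) * ‖x‖ ^ 2 := by
    rw [← Real.rpow_natCast ‖x‖ 2, ← Real.rpow_add hxpos]; norm_num
  rcases le_or_gt ‖v‖ ‖x‖ with hle | hlt
  · -- tangent line of the concave function `u ↦ u ^ (α / 2)` at `u = ‖x‖ ^ 2`
    set s : ℝ := (2 * inner ℝ x v + ‖v‖ ^ 2) / ‖x‖ ^ 2 with hs
    have hsq : ‖x + v‖ ^ 2 = ‖x‖ ^ 2 * (1 + s) := by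
      rw [norm_add_sq_real, hs]; field_simp; ring
    have hs1 : -1 ≤ s := by
      have h : 0 ≤ ‖x‖ ^ 2 * (1 + s) := hsq ▸ sq_nonneg _
      have := (mul_nonneg_iff_of_pos_left (by positivity)).1 h
      linarith
    have hB := rpow_one_add_le_one_add_mul_self hs1 (p := α / 2) (by linarith) (by linarith)
    have e1 : ‖x + v‖ ^ α = (‖x + v‖ ^ 2) ^ (α / 2) := by
      rw [← Real.rpow_natCast, ← Real.rpow_mul (norm_nonneg _)]; congr 1; push_cast; ring
    have e2 : (‖x‖ ^ 2) ^ (α / 2) = ‖x‖ ^ α := by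
      rw [← Real.rpow_natCast, ← Real.rpow_mul (norm_nonneg _)]; congr 1; push_cast; ring
    rw [e1, hsq, Real.mul_rpow (by positivity) (by linarith), e2]
    have hlast : ‖x‖ ^ (α - 2) * ‖v‖ ^ 2 ≤ ‖v‖ ^ α := by
      rcases hv0.eq_or_lt with hv | hv
      · rw [← hv]; simp; positivity
      · have e3 : ‖v‖ ^ α = ‖v‖ ^ (α - 2) * ‖v‖ ^ 2 := by
          rw [← Real.rpow_natCast ‖v‖ 2, ← Real.rpow_add hv]; norm_num
        rw [e3]
        gcongr ?_ * _
        exact Real.rpow_le_rpow_of_nonpos hv hle (by linarith)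
    have hvα : 0 ≤ ‖v‖ ^ α := by positivity
    have hxm : 0 ≤ ‖x‖ ^ (α - 2) * ‖v‖ ^ 2 := by positivity
    calc ‖x‖ ^ α * (1 + s) ^ (α / 2) ≤ ‖x‖ ^ α * (1 + α / 2 * s) := by gcongr
      _ = ‖x‖ ^ α + α * ‖x‖ ^ (α - 2) * inner ℝ x v + α / 2 * (‖x‖ ^ (α - 2) * ‖v‖ ^ 2) := by
          rw [mul_add, mul_one, hr2, hs]; field_simp; ring
      _ ≤ _ := by nlinarith
  · have h4 : (2 * ‖v‖) ^ α ≤ 4 * ‖v‖ ^ α := by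
      rw [Real.mul_rpow (by norm_num) hv0]
      gcongr
      calc (2 : ℝ) ^ α ≤ 2 ^ (2 : ℝ) := Real.rpow_le_rpow_of_exponent_le (by norm_num) h2
        _ = 4 := by norm_num
    have hsum : ‖x + v‖ ^ α ≤ (2 * ‖v‖) ^ α :=
      Real.rpow_le_rpow (norm_nonneg _) ((norm_add_le _ _).trans (by linarith)) (by linarith)
    have hvpos : 0 < ‖v‖ := hxpos.trans hlt
    have hin : ‖x‖ ^ (α - 2) * (-inner ℝ x v) ≤ ‖v‖ ^ α := by
      calc ‖x‖ ^ (α - 2) * (-inner ℝ x v) ≤ ‖x‖ ^ (α - 2) * (‖x‖ * ‖v‖) := by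
            gcongr
            have := abs_real_inner_le_norm x v
            linarith [neg_abs_le (inner ℝ x v)]
        _ = ‖x‖ ^ (α - 1) * ‖v‖ := by
            rw [← mul_assoc, ← Real.rpow_add_one hxpos.ne']; ring_nf
        _ ≤ ‖v‖ ^ (α - 1) * ‖v‖ := by
            gcongr
        _ = ‖v‖ ^ α := by rw [← Real.rpow_add_one hvpos.ne']; ring_nf
    have hxα : 0 ≤ ‖x‖ ^ α := by positivity
    have hvα : 0 ≤ ‖v‖ ^ α := by positivity
    have : α * (‖x‖ ^ (α - 2) * (-inner ℝ x v)) ≤ 2 * ‖v‖ ^ α :=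
      (mul_le_mul_of_nonneg_left hin (by linarith)).trans (by gcongr)
    nlinarith

/-- Young's inequality, with the optimal constant. -/
lemma two_mul_mul_le_rpow_add {α : ℝ} (h1 : 1 < α) {h w e : ℝ} (hh : 0 < h) (hw : 0 < w)
    (he : 0 ≤ e) :
    2 * h * e ≤ w * e ^ α +
      (α - 1) * (2 / α) ^ (α / (α - 1)) * (h ^ (α / (α - 1)) * w ^ (-(1 / (α - 1)))) := by
  have ha : 0 < α - 1 := by linarith
  have hα : 0 < α := by linarith
  -- the point where `2 * h * e - w * e ^ α` is largest
  set e₀ : ℝ := (2 * h / (α * w)) ^ (1 / (α - 1)) with he₀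
  have hbase : 0 < 2 * h / (α * w) := by positivity
  have he₀pos : 0 < e₀ := Real.rpow_pos_of_pos hbase _
  have hpow : e₀ ^ (α - 1) = 2 * h / (α * w) := by
    rw [he₀, ← Real.rpow_mul hbase.le, one_div_mul_cancel ha.ne', Real.rpow_one]
  have hpowα : w * e₀ ^ α = 2 * h * e₀ / α := by
    have : e₀ ^ α = e₀ ^ (α - 1) * e₀ := by rw [← Real.rpow_add_one he₀pos.ne']; ring_nf
    rw [this, hpow]; field_simp
  have hB := one_add_mul_self_le_rpow_one_add (s := e / e₀ - 1)
    (by have : 0 ≤ e / e₀ := by positivity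
        linarith) h1.le
  rw [add_sub_cancel, Real.div_rpow he he₀pos.le] at hB
  have hB' : w * e₀ ^ α * (1 + α * (e / e₀ - 1)) ≤ w * e ^ α := by
    calc w * e₀ ^ α * (1 + α * (e / e₀ - 1)) ≤ w * e₀ ^ α * (e ^ α / e₀ ^ α) := by gcongr
      _ = w * e ^ α := by field_simp
  have hconst : (α - 1) * (2 / α) ^ (α / (α - 1)) * (h ^ (α / (α - 1)) * w ^ (-(1 / (α - 1))))
      = (α - 1) * (2 * h / α) * e₀ := by
    have hexp : α / (α - 1) = 1 + 1 / (α - 1) := by field_simp; ring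
    have hsplit : 2 * h / (α * w) = 2 / α * h * w⁻¹ := by field_simp
    rw [he₀, hsplit, Real.mul_rpow (by positivity) (by positivity),
      Real.mul_rpow (by positivity) hh.le, Real.inv_rpow hw.le, Real.rpow_neg hw.le, hexp,
      Real.rpow_add (by positivity), Real.rpow_add hh, Real.rpow_one, Real.rpow_one]
    ring
  rw [hconst]
  rw [hpowα] at hB'
  have : 2 * h * e₀ / α * (1 + α * (e / e₀ - 1)) = 2 * h * e - (α - 1) * (2 * h / α) * e₀ := by
    field_simp; ring
  linarith

lemma norm_smul_add_rpow_le {E : Type*} [NormedAddCommGroup E] [NormedSpace ℝ E] {α : ℝ}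
    (h1 : 1 < α) {c : ℝ} (hc : 0 < c) (hc1 : c ≤ 1) (x y : E) :
    ‖(1 - c) • x + y‖ ^ α ≤ (1 - c) * ‖x‖ ^ α + c ^ (1 - α) * ‖y‖ ^ α := by
  have h0 : ‖(1 - c) • x + y‖ ≤ (1 - c) * ‖x‖ + c * (‖y‖ / c) := by
    refine (norm_add_le _ _).trans (le_of_eq ?_)
    rw [norm_smul, Real.norm_of_nonneg (by linarith), mul_div_cancel₀ _ hc.ne']
  have hconv := (convexOn_rpow h1.le).2 (Set.mem_Ici.2 (norm_nonneg x))
    (Set.mem_Ici.2 (div_nonneg (norm_nonneg y) hc.le)) (show 0 ≤ 1 - c by linarith) hc.le (by ring)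
  simp only [smul_eq_mul] at hconv
  refine (Real.rpow_le_rpow (norm_nonneg _) h0 (by linarith)).trans (hconv.trans (le_of_eq ?_))
  rw [Real.div_rpow (norm_nonneg _) hc.le, Real.rpow_sub hc, Real.rpow_one]
  ring

lemma norm_sum_smul_rpow_le {E : Type*} [NormedAddCommGroup E] [NormedSpace ℝ E] {α : ℝ}
    (h1 : 1 < α) (S : Finset ℕ) (c : ℕ → ℝ) (v : ℕ → E) :
    ‖∑ t ∈ S, c t • v t‖ ^ α ≤ (∑ t ∈ S, |c t|) ^ (α - 1) * ∑ t ∈ S, |c t| * ‖v t‖ ^ α := by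
  have hα : 0 < α := by linarith
  have h0 : ‖∑ t ∈ S, c t • v t‖ ≤ ∑ t ∈ S, |c t| * ‖v t‖ :=
    (norm_sum_le _ _).trans (Finset.sum_le_sum fun t _ => by rw [norm_smul, Real.norm_eq_abs])
  have hH := Real.inner_le_weight_mul_Lp_of_nonneg S h1.le (fun t => |c t|) (fun t => ‖v t‖)
    (fun t => abs_nonneg _) (fun t => norm_nonneg _)
  have hc : 0 ≤ ∑ t ∈ S, |c t| := Finset.sum_nonneg fun t _ => abs_nonneg _
  have hv : 0 ≤ ∑ t ∈ S, |c t| * ‖v t‖ ^ α := Finset.sum_nonneg fun t _ => by positivity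
  refine (Real.rpow_le_rpow (norm_nonneg _) (h0.trans hH) hα.le).trans (le_of_eq ?_)
  rw [Real.mul_rpow (by positivity) (by positivity), ← Real.rpow_mul hc, ← Real.rpow_mul hv,
    inv_mul_cancel₀ hα.ne', Real.rpow_one]
  congr 2
  field_simp

end Powers

/-! ### Descent along a normalized direction -/

section Descent

variable {n : ℕ}

lemma le_add_inner_gradient {f : Eucl n → ℝ} (hf : ContDiff ℝ 1 f) {L₁ : ℝ}
    (hL : ∀ x y, ‖gradient f x - gradient f y‖ ≤ L₁ * ‖x - y‖) (x d : Eucl n) :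
    f (x + d) ≤ f x + inner ℝ (gradient f x) d + L₁ / 2 * ‖d‖ ^ 2 := by
  have hF : ContDiff ℝ 1 (fun s : ℝ => f (x + s • d)) := by fun_prop
  have hderiv : ∀ s : ℝ, iteratedDeriv 1 (fun s : ℝ => f (x + s • d)) s
      = inner ℝ (gradient f (x + s • d)) d := by
    intro s
    have hf' : ContDiff ℝ (1 : ℕ) f := by exact_mod_cast hf
    rw [iteratedDeriv_comp_line hf', iteratedFDeriv_one_apply, inner_gradient_left]
  have h := norm_sub_taylor_le (m := 1) (g := fun s : ℝ => f (x + s • d)) (by exact_mod_cast hF)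
    (L := L₁ * ‖d‖ ^ 2) (fun s hs => by
      rw [hderiv, hderiv, ← inner_sub_left]
      refine (norm_inner_le_norm _ _).trans ?_
      have := hL (x + s • d) (x + (0 : ℝ) • d)
      rw [zero_smul, add_zero, add_sub_cancel_left, norm_smul, Real.norm_of_nonneg hs] at this
      rw [zero_smul, add_zero]
      calc _ ≤ L₁ * (s * ‖d‖) * ‖d‖ := by gcongr
        _ = _ := by ring) zero_le_one
  rw [Finset.sum_range_succ, Finset.sum_range_one, hderiv] at h
  have h' := (abs_le.1 (Real.norm_eq_abs _ ▸ h)).2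
  norm_num [Nat.factorial] at h'
  rw [inner_gradient_left]
  linarith

/-- One step of normalized descent along `m`, in terms of the error of `m` as an estimate of the
gradient. If `m = 0` the point does not move, and the error is the whole gradient. -/
lemma descent_step {f : Eucl n → ℝ} (hf : ContDiff ℝ 1 f) {L₁ : ℝ} (hL₁ : 0 < L₁)
    (hL : ∀ x y, ‖gradient f x - gradient f y‖ ≤ L₁ * ‖x - y‖) (x m : Eucl n) {h : ℝ} (hh : 0 < h) :
    f (x - h • (‖m‖⁻¹ • m)) ≤ f x - h * ‖gradient f x‖ + 2 * h * ‖m - gradient f x‖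
      + L₁ / 2 * h ^ 2 := by
  have hd := le_add_inner_gradient hf hL x (-(h • (‖m‖⁻¹ • m)))
  rw [← sub_eq_add_neg] at hd
  rcases eq_or_ne m 0 with rfl | hm
  · simp only [smul_zero, sub_zero, zero_sub, norm_neg]
    have := mul_nonneg hh.le (norm_nonneg (gradient f x))
    have : 0 ≤ L₁ / 2 * h ^ 2 := by positivity
    linarith
  have hmpos : 0 < ‖m‖ := norm_pos_iff.2 hm
  have hnorm : ‖-(h • (‖m‖⁻¹ • m))‖ = h := by
    rw [norm_neg, norm_smul, norm_smul, norm_inv, norm_norm, inv_mul_cancel₀ hmpos.ne', mul_one,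
      Real.norm_of_nonneg hh.le]
  rw [hnorm, inner_neg_right, inner_smul_right, inner_smul_right] at hd
  have hin : ‖m‖ * (‖m‖ - ‖m - gradient f x‖) ≤ inner ℝ (gradient f x) m := by
    have e : inner ℝ (gradient f x) m = ‖m‖ ^ 2 - inner ℝ (m - gradient f x) m := by
      rw [inner_sub_left, real_inner_self_eq_norm_sq]; ring
    have := real_inner_le_norm (m - gradient f x) m
    rw [e]; nlinarith
  have hin' : ‖m‖ - ‖m - gradient f x‖ ≤ ‖m‖⁻¹ * inner ℝ (gradient f x) m := by
    rw [inv_mul_eq_div, le_div_iff₀ hmpos, mul_comm]; exact hin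
  have htri : ‖gradient f x‖ ≤ ‖m‖ + ‖m - gradient f x‖ := by
    calc ‖gradient f x‖ = ‖m - (m - gradient f x)‖ := by congr 1; abel
      _ ≤ _ := norm_sub_le _ _
  have := mul_le_mul_of_nonneg_left (show ‖gradient f x‖ - 2 * ‖m - gradient f x‖ ≤
    ‖m‖⁻¹ * inner ℝ (gradient f x) m by linarith) hh.le
  linarith

end Descent

/-! ### The parameter sequences -/

section Parameters

lemma eta_eq (p k : ℕ) :
    eta p k = ((k : ℝ) + 4) ^ (-((2 * (p : ℝ) + 1) / (3 * (p : ℝ) + 1))) := by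
  rw [eta, Real.rpow_neg (by positivity), one_div]

lemma gamma_eq (p k : ℕ) :
    gamma p k = ((k : ℝ) + 4) ^ (-((2 * (p : ℝ)) / (3 * (p : ℝ) + 1))) := by
  rw [gamma, Real.rpow_neg (by positivity), one_div]

lemma eta_pos (p k : ℕ) : 0 < eta p k := by unfold eta; positivity

lemma gamma_pos (p k : ℕ) : 0 < gamma p k := by unfold gamma; positivity

lemma gamma_le_one (p k : ℕ) : gamma p k ≤ 1 := by
  rw [gamma_eq]
  refine Real.rpow_le_one_of_one_le_of_nonpos ?_ ?_
  · have : (0 : ℝ) ≤ k := k.cast_nonneg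
    linarith
  · exact neg_nonpos.2 (by positivity)

lemma inv_le_gamma (p k : ℕ) : ((k : ℝ) + 4)⁻¹ ≤ gamma p k := by
  have hk : (0 : ℝ) ≤ k := k.cast_nonneg
  have hp : (0 : ℝ) ≤ p := p.cast_nonneg
  rw [gamma_eq, ← Real.rpow_neg_one]
  refine Real.rpow_le_rpow_of_exponent_le (by linarith) (neg_le_neg ?_)
  rw [div_le_one (by positivity)]; linarith

/-- The exponent of the weight of the error term in the potential. It balances the noise
accumulated by the momentum against the remainder in Young's inequality. -/
noncomputable def potExp (p : ℕ) (α : ℝ) : ℝ :=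
  (2 * p * (α - 1) ^ 2 / α - 1) / (3 * p + 1)

/-- The excess over `-1` of the exponent of the noise terms. -/
noncomputable def noiseExp (p : ℕ) (α : ℝ) : ℝ := p * (2 - α) / (α * (3 * p + 1))

/-- The weight, at iteration `k`, of the error of the momentum in the potential. -/
noncomputable def potWeight (p : ℕ) (α : ℝ) (k : ℕ) : ℝ := ((k : ℝ) + 4) ^ potExp p α

lemma potWeight_pos (p : ℕ) (α : ℝ) (k : ℕ) : 0 < potWeight p α k := by
  unfold potWeight; positivity

variable {p : ℕ} {α : ℝ}

lemma potExp_le (h1 : 1 < α) (h2 : α ≤ 2) : potExp p α ≤ 1 / 3 := by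
  have hp : (0 : ℝ) ≤ p := p.cast_nonneg
  rw [potExp, div_le_div_iff₀ (by positivity) (by norm_num)]
  have h : 2 * p * (α - 1) ^ 2 / α ≤ p := by
    rw [div_le_iff₀ (by linarith)]
    have : 2 * (α - 1) ^ 2 ≤ α := by nlinarith
    nlinarith
  linarith

lemma potWeight_zero_le (h1 : 1 < α) (h2 : α ≤ 2) :
    potWeight p α 0 ≤ (4 : ℝ) ^ ((1 : ℝ) / 3) := by
  rw [potWeight, Nat.cast_zero, zero_add]
  exact Real.rpow_le_rpow_of_exponent_le (by norm_num) (potExp_le h1 h2)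

lemma potWeight_succ_le (h1 : 1 < α) (h2 : α ≤ 2) (k : ℕ) :
    potWeight p α (k + 1) ≤ potWeight p α k * (1 + gamma p k / 3) := by
  have hk : (0 : ℝ) ≤ k := k.cast_nonneg
  have hγ := inv_le_gamma p k
  have e : ((k + 1 : ℕ) : ℝ) + 4 = ((k : ℝ) + 4) * (1 + ((k : ℝ) + 4)⁻¹) := by
    field_simp; push_cast; ring
  have hinv : 0 ≤ ((k : ℝ) + 4)⁻¹ := by positivity
  rw [potWeight, e, Real.mul_rpow (by positivity) (by positivity), potWeight]
  gcongr
  calc (1 + ((k : ℝ) + 4)⁻¹) ^ potExp p α ≤ (1 + ((k : ℝ) + 4)⁻¹) ^ ((1 : ℝ) / 3) :=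
        Real.rpow_le_rpow_of_exponent_le (by linarith) (potExp_le h1 h2)
    _ ≤ 1 + (1 : ℝ) / 3 * ((k : ℝ) + 4)⁻¹ :=
        rpow_one_add_le_one_add_mul_self (by linarith) (by norm_num) (by norm_num)
    _ ≤ 1 + gamma p k / 3 := by linarith

lemma potWeight_succ_le_two_mul (h1 : 1 < α) (h2 : α ≤ 2) (k : ℕ) :
    potWeight p α (k + 1) ≤ 2 * potWeight p α k := by
  have h := potWeight_succ_le (p := p) h1 h2 k
  have := gamma_le_one p k
  nlinarith [potWeight_pos p α k]

lemma potWeight_succ_mul_le (h1 : 1 < α) (h2 : α ≤ 2) (k : ℕ) :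
    potWeight p α (k + 1) * (1 - gamma p k) ≤ potWeight p α k * (1 - gamma p k / 30) := by
  have h := potWeight_succ_le (p := p) h1 h2 k
  have h1' := gamma_le_one p k
  have h0 := gamma_pos p k
  calc _ ≤ potWeight p α k * (1 + gamma p k / 3) * (1 - gamma p k) := by
        gcongr
    _ = potWeight p α k * ((1 + gamma p k / 3) * (1 - gamma p k)) := by ring
    _ ≤ _ := by
        gcongr
        · exact (potWeight_pos p α k).le
        · nlinarith

lemma eta_sq_le (p k : ℕ) : eta p k ^ 2 ≤ ((k : ℝ) + 4)⁻¹ := by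
  have hk : (0 : ℝ) ≤ k := k.cast_nonneg
  have hp : (0 : ℝ) ≤ p := p.cast_nonneg
  rw [eta_eq, ← Real.rpow_natCast, ← Real.rpow_mul (by positivity), ← Real.rpow_neg_one]
  refine Real.rpow_le_rpow_of_exponent_le (by linarith) ?_
  push_cast
  rw [neg_mul, neg_le_neg_iff, div_mul_eq_mul_div, le_div_iff₀ (by positivity)]
  linarith

/-- The weighted noise per iteration. -/
lemma potWeight_mul_gamma_rpow (h1 : 1 < α) (k : ℕ) :
    potWeight p α k * gamma p k ^ α = ((k : ℝ) + 4) ^ (-1 + noiseExp p α) := by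
  have hκ : (0 : ℝ) < (k : ℝ) + 4 := by positivity
  rw [potWeight, gamma_eq, ← Real.rpow_mul hκ.le, ← Real.rpow_add hκ]
  congr 1
  rw [potExp, noiseExp]
  have : (0 : ℝ) < 3 * p + 1 := by positivity
  have : α ≠ 0 := by linarith
  field_simp
  ring

/-- The remainder in Young's inequality has the same order as the weighted noise. -/
lemma eta_rpow_mul_potWeight_rpow (h1 : 1 < α) (k : ℕ) :
    eta p k ^ (α / (α - 1)) * (potWeight p α k * gamma p k) ^ (-(1 / (α - 1)))
      = ((k : ℝ) + 4) ^ (-1 + noiseExp p α) := by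
  have hκ : (0 : ℝ) < (k : ℝ) + 4 := by positivity
  rw [potWeight, gamma_eq, eta_eq, ← Real.rpow_add hκ, ← Real.rpow_mul hκ.le,
    ← Real.rpow_mul hκ.le, ← Real.rpow_add hκ]
  congr 1
  rw [potExp, noiseExp]
  have : (0 : ℝ) < 3 * p + 1 := by positivity
  have : α ≠ 0 := by linarith
  have : α - 1 ≠ 0 := by linarith
  field_simp
  ring

/-- The weighted bias per iteration. -/
lemma potWeight_mul_bias_le (hp : 1 ≤ p) (h1 : 1 < α) (h2 : α ≤ 2) (k : ℕ) :
    potWeight p α k * (gamma p k ^ (1 - α) * (eta p k ^ p * (gamma p k ^ (p - 1))⁻¹) ^ α)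
      ≤ ((k : ℝ) + 4)⁻¹ := by
  have hk : (0 : ℝ) ≤ k := k.cast_nonneg
  have hκ : (0 : ℝ) < (k : ℝ) + 4 := by positivity
  have hp0 : (1 : ℝ) ≤ p := by exact_mod_cast hp
  have hpc : ((p - 1 : ℕ) : ℝ) = p - 1 := by rw [Nat.cast_sub hp, Nat.cast_one]
  rw [potWeight, gamma_eq, eta_eq, ← Real.rpow_natCast, ← Real.rpow_natCast _ (p - 1),
    ← Real.rpow_mul hκ.le, ← Real.rpow_mul hκ.le, ← Real.rpow_mul hκ.le, ← Real.rpow_neg hκ.le,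
    ← Real.rpow_add hκ, ← Real.rpow_mul hκ.le, ← Real.rpow_add hκ, ← Real.rpow_add hκ,
    ← Real.rpow_neg_one, hpc]
  refine Real.rpow_le_rpow_of_exponent_le (by linarith) ?_
  have h : 2 * p * (α - 1) ^ 2 / α ≤ p * (α - 1) := by
    rw [div_le_iff₀ (by linarith)]
    have : 2 * (α - 1) ≤ α := by linarith
    have h3 : 0 ≤ p * (α - 1) := by nlinarith
    nlinarith
  have hr : (0 : ℝ) < 3 * p + 1 := by positivity
  have e : potExp p α + (-(2 * p / (3 * p + 1)) * (1 - α) +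
      (-((2 * p + 1) / (3 * p + 1)) * p + -(-(2 * p / (3 * p + 1)) * (p - 1))) * α)
      = ((2 * p * (α - 1) ^ 2 / α - 1) - 2 * p - p * α) / (3 * p + 1) := by
    rw [potExp]; field_simp; ring
  rw [e, div_le_iff₀ hr]
  linarith

lemma noiseExp_nonneg (h1 : 1 < α) (h2 : α ≤ 2) : 0 ≤ noiseExp p α := by
  rw [noiseExp]
  have : 0 ≤ 2 - α := by linarith
  have : 0 < α := by linarith
  positivity

lemma noiseExp_le_one (h1 : 1 < α) : noiseExp p α ≤ 1 := by
  have hp : (0 : ℝ) ≤ p := p.cast_nonneg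
  have hα : 0 < α := by linarith
  rw [noiseExp, div_le_one (by positivity)]
  nlinarith

lemma sum_inv_le_log {K : ℕ} (hK : 2 ≤ K) :
    ∑ k ∈ Finset.range K, ((k : ℝ) + 4)⁻¹ ≤ Real.log K := by
  have h : ∀ K : ℕ, ∑ k ∈ Finset.range K, ((k : ℝ) + 4)⁻¹
      ≤ Real.log ((K : ℝ) + 3) - Real.log 3 := by
    intro K
    induction K with
    | zero => simp
    | succ K ih =>
      rw [Finset.sum_range_succ]
      have h1 := Real.one_sub_inv_le_log_of_pos (x := ((K : ℝ) + 4) / ((K : ℝ) + 3)) (by positivity)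
      rw [Real.log_div (by positivity) (by positivity), inv_div] at h1
      have h2 : 1 - ((K : ℝ) + 3) / ((K : ℝ) + 4) = ((K : ℝ) + 4)⁻¹ := by field_simp; ring
      have h3 : (((K + 1 : ℕ) : ℝ) + 3) = (K : ℝ) + 4 := by push_cast; ring
      rw [h3]
      linarith
  have hK' : (2 : ℝ) ≤ K := by exact_mod_cast hK
  refine (h K).trans ?_
  rw [← Real.log_div (by positivity) (by norm_num)]
  exact Real.log_le_log (by positivity) (by linarith)

lemma sum_rpow_le {K : ℕ} (hK : 3 ≤ K) (h1 : 1 < α) (h2 : α ≤ 2) :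
    ∑ k ∈ Finset.range K, ((k : ℝ) + 4) ^ (-1 + noiseExp p α)
      ≤ 2 * (K : ℝ) ^ noiseExp p α * Real.log K := by
  have hδ := noiseExp_nonneg (p := p) h1 h2
  have hδ1 := noiseExp_le_one (p := p) h1
  have hK' : (3 : ℝ) ≤ K := by exact_mod_cast hK
  have hterm : ∀ k ∈ Finset.range K, ((k : ℝ) + 4) ^ (-1 + noiseExp p α)
      ≤ 2 * (K : ℝ) ^ noiseExp p α * ((k : ℝ) + 4)⁻¹ := by
    intro k hk
    have hκ : (0 : ℝ) < (k : ℝ) + 4 := by positivity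
    have hkK : (k : ℝ) + 1 ≤ K := by exact_mod_cast Finset.mem_range.1 hk
    rw [Real.rpow_add hκ, Real.rpow_neg_one, mul_comm]
    gcongr
    calc ((k : ℝ) + 4) ^ noiseExp p α ≤ (2 * (K : ℝ)) ^ noiseExp p α :=
          Real.rpow_le_rpow hκ.le (by linarith) hδ
      _ = 2 ^ noiseExp p α * (K : ℝ) ^ noiseExp p α :=
          Real.mul_rpow (by norm_num) (by positivity)
      _ ≤ 2 * (K : ℝ) ^ noiseExp p α := by
          gcongr
          calc (2 : ℝ) ^ noiseExp p α ≤ 2 ^ (1 : ℝ) :=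
                Real.rpow_le_rpow_of_exponent_le (by norm_num) hδ1
            _ = 2 := by norm_num
  refine (Finset.sum_le_sum hterm).trans ?_
  rw [← Finset.mul_sum]
  gcongr
  exact sum_inv_le_log (by omega)

/-- The last step size is the smallest one, and is comparable with `K ^ (p / (3 * p + 1)) / K`. -/
lemma one_le_mul_eta {K : ℕ} (hK : 3 ≤ K) {k : ℕ} (hk : k < K) :
    1 ≤ 2 * (K : ℝ) * (K : ℝ) ^ (-((p : ℝ) / (3 * p + 1))) * eta p k := by
  have hK' : (3 : ℝ) ≤ K := by exact_mod_cast hK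
  have hK0 : (0 : ℝ) < K := by linarith
  have hp : (0 : ℝ) ≤ p := p.cast_nonneg
  have hkK : (k : ℝ) + 1 ≤ K := by exact_mod_cast hk
  have hb0 : 0 ≤ (2 * (p : ℝ) + 1) / (3 * p + 1) := by positivity
  have hb1 : (2 * (p : ℝ) + 1) / (3 * p + 1) ≤ 1 := by
    rw [div_le_one (by positivity)]; linarith
  have h : ((k : ℝ) + 4) ^ ((2 * (p : ℝ) + 1) / (3 * p + 1))
      ≤ 2 * (K : ℝ) ^ ((2 * (p : ℝ) + 1) / (3 * p + 1)) := by
    calc _ ≤ (2 * (K : ℝ)) ^ ((2 * (p : ℝ) + 1) / (3 * p + 1)) :=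
          Real.rpow_le_rpow (by positivity) (by linarith) hb0
      _ = 2 ^ ((2 * (p : ℝ) + 1) / (3 * p + 1)) * (K : ℝ) ^ ((2 * (p : ℝ) + 1) / (3 * p + 1)) :=
          Real.mul_rpow (by norm_num) hK0.le
      _ ≤ _ := by
          gcongr
          calc (2 : ℝ) ^ ((2 * (p : ℝ) + 1) / (3 * p + 1)) ≤ 2 ^ (1 : ℝ) :=
                Real.rpow_le_rpow_of_exponent_le (by norm_num) hb1
            _ = 2 := by norm_num
  have e : (K : ℝ) * (K : ℝ) ^ (-((p : ℝ) / (3 * p + 1)))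
      = (K : ℝ) ^ ((2 * (p : ℝ) + 1) / (3 * p + 1)) := by
    rw [← Real.rpow_one_add' hK0.le]
    · congr 1; field_simp; ring
    · have : (0 : ℝ) < 3 * p + 1 := by positivity
      have h : 1 + -((p : ℝ) / (3 * p + 1)) = (2 * p + 1) / (3 * p + 1) := by field_simp; ring
      rw [h]; positivity
  rw [mul_assoc 2, e, eta, mul_one_div, one_le_div (by positivity)]
  exact h

/-- The threshold `y ≥ A ln A` suffices for `y ≥ (A / 2) ln y`, whatever the sign of `ln A`. -/
lemma half_mul_log_le {A y : ℝ} (hA : 0 < A) (hy : 0 < y) (h : A * Real.log A ≤ y) :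
    A / 2 * Real.log y ≤ y := by
  -- `log y ≤ log c - 1 + y / c` is the tangent line of `log` at `c`
  have tangent : ∀ c : ℝ, 0 < c → Real.log y ≤ Real.log c - 1 + y / c := by
    intro c hc
    have := Real.log_le_sub_one_of_pos (div_pos hy hc)
    rw [Real.log_div hy.ne' hc.ne'] at this
    linarith
  have h1 := tangent A hA
  have h2 : A / 2 * Real.log y ≤ A / 2 * (Real.log A - 1 + y / A) := by gcongr
  have h3 : A / 2 * (Real.log A - 1 + y / A) = A * Real.log A / 2 - A / 2 + y / 2 := by
    field_simp
  linarith

/-- From the threshold to the bound `M * ln K ≤ K ^ s * ε / 2`, where `s = 1 / r`. -/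
lemma mul_log_le_of_threshold {A r M ε : ℝ} (hr : 0 < r) (hA : 0 < A) {K : ℕ} (hK : 1 ≤ K)
    (hε : 0 < ε) (hM : 4 * r * M / ε = A) (h : (A * Real.log A) ^ r ≤ K) :
    M * (K : ℝ) ^ (-(1 / r)) * Real.log K ≤ ε / 2 := by
  have hK' : (0 : ℝ) < K := by exact_mod_cast hK
  have hy : 0 < (K : ℝ) ^ (1 / r) := by positivity
  have hAy : A * Real.log A ≤ (K : ℝ) ^ (1 / r) := by
    rcases le_or_gt 0 (A * Real.log A) with h0 | h0
    · calc A * Real.log A = ((A * Real.log A) ^ r) ^ (1 / r) := by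
            rw [← Real.rpow_mul h0, mul_one_div_cancel hr.ne', Real.rpow_one]
        _ ≤ _ := Real.rpow_le_rpow (by positivity) h (by positivity)
    · -- the power with a negative base in `h` carries no information, and none is needed
      linarith
  have hlog := half_mul_log_le hA hy hAy
  rw [Real.log_rpow hK'] at hlog
  rw [Real.rpow_neg hK'.le, mul_assoc, inv_mul_eq_div, mul_div_assoc', div_le_iff₀ hy]
  have e : A / 2 * (1 / r * Real.log K) = 2 / ε * (M * Real.log K) := by
    rw [← hM]; field_simp; ring
  rw [e, div_mul_eq_mul_div, div_le_iff₀ hε] at hlog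
  linarith

end Parameters

/-! ### Stochastic gradients at random points -/

section Noise

variable {n : ℕ} {Ξ : Type*} [MeasurableSpace Ξ] {P : Measure Ξ}
  {f : Eucl n → ℝ} {G : Eucl n → Ξ → Eucl n} {flow L₁ σ α : ℝ}
  {Ω : Type*}

lemma measurable_rpow_smul [MeasurableSpace Ω] {A : Ω → Eucl n} (hA : Measurable A) (a : ℝ) :
    Measurable (fun ω => ‖A ω‖ ^ a • A ω) :=
  (hA.norm.pow_const a).smul hA

lemma BasicAssumption.continuous_gradient (h : BasicAssumption P f G flow L₁ σ α) :
    Continuous (gradient f) := by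
  refine (LipschitzWith.of_dist_le_mul (K := ⟨L₁, h.L₁_pos.le⟩) fun x y => ?_).continuous
  rw [dist_eq_norm, dist_eq_norm]
  exact h.lipschitz_gradient x y

lemma BasicAssumption.measurable_noise (h : BasicAssumption P f G flow L₁ σ α) :
    Measurable (fun y : Eucl n × Ξ => G y.1 y.2 - gradient f y.1) :=
  h.measurable_G.sub (h.continuous_gradient.measurable.comp measurable_fst)

variable [mΩ : MeasurableSpace Ω] {μ : Measure Ω} [IsProbabilityMeasure μ]

lemma map_prodMk_eq [SFinite P] {β : Type*} [MeasurableSpace β] {Y : Ω → β} {s : Ω → Ξ} (hY : Measurable Y)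
    (hs : Measurable s) (hlaw : μ.map s = P) (hind : IndepFun Y s μ) :
    μ.map (fun ω => (Y ω, s ω)) = (μ.map Y).prod P := by
  rw [(indepFun_iff_map_prod_eq_prod_map_map hY.aemeasurable hs.aemeasurable).1 hind, hlaw]

/-- The moment bound holds at a random point independent of the sample. -/
lemma noise_moment [IsProbabilityMeasure P] (h : BasicAssumption P f G flow L₁ σ α) {Z : Ω → Eucl n} {s : Ω → Ξ}
    (hZ : Measurable Z) (hs : Measurable s) (hlaw : μ.map s = P) (hind : IndepFun Z s μ) :
    Integrable (fun ω => ‖G (Z ω) (s ω) - gradient f (Z ω)‖ ^ α) μ ∧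
      ∫ ω, ‖G (Z ω) (s ω) - gradient f (Z ω)‖ ^ α ∂μ ≤ σ ^ α := by
  set φ : Eucl n × Ξ → ℝ := fun y => ‖G y.1 y.2 - gradient f y.1‖ ^ α with hφ
  have hφm : Measurable φ := h.measurable_noise.norm.pow_const α
  have hφ0 : ∀ y, 0 ≤ φ y := fun y => by positivity
  have hmap := map_prodMk_eq hZ hs hlaw hind
  have hpair : Measurable (fun ω => (Z ω, s ω)) := hZ.prodMk hs
  have : IsProbabilityMeasure (μ.map Z) := Measure.isProbabilityMeasure_map hZ.aemeasurable
  have hnorm : ∀ z, ∫ x, ‖φ (z, x)‖ ∂P = ∫ x, φ (z, x) ∂P := fun z =>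
    integral_congr_ae (Filter.Eventually.of_forall fun x => Real.norm_of_nonneg (hφ0 _))
  have hbound : ∀ z, ∫ x, φ (z, x) ∂P ≤ σ ^ α := fun z => h.moment_le z
  have hint1 : Integrable (fun z => ∫ x, φ (z, x) ∂P) (μ.map Z) := by
    refine Integrable.of_bound (C := σ ^ α)
      (hφm.stronglyMeasurable.integral_prod_right').aestronglyMeasurable
      (Filter.Eventually.of_forall fun z => ?_)
    rw [Real.norm_of_nonneg (integral_nonneg fun x => hφ0 _)]
    exact hbound z
  have hint : Integrable φ ((μ.map Z).prod P) := by
    rw [integrable_prod_iff hφm.aestronglyMeasurable]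
    refine ⟨Filter.Eventually.of_forall fun z => h.integrable_moment z, ?_⟩
    simpa only [hnorm] using hint1
  constructor
  · have := hmap ▸ hint
    exact (integrable_map_measure hφm.aestronglyMeasurable hpair.aemeasurable).1 this
  · have e : ∫ ω, φ (Z ω, s ω) ∂μ = ∫ y, φ y ∂((μ.map Z).prod P) := by
      rw [← hmap, integral_map hpair.aemeasurable hφm.aestronglyMeasurable]
    calc ∫ ω, φ (Z ω, s ω) ∂μ = ∫ z, ∫ x, φ (z, x) ∂P ∂(μ.map Z) := by
          rw [e, integral_prod _ hint]
      _ ≤ ∫ _z, σ ^ α ∂(μ.map Z) := integral_mono hint1 (integrable_const _) hbound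
      _ = σ ^ α := by simp

/-- The noise at a random point is orthogonal to every vector independent of the sample. -/
lemma integral_inner_noise_eq_zero [IsProbabilityMeasure P] (h : BasicAssumption P f G flow L₁ σ α)
    {H Z : Ω → Eucl n} {s : Ω → Ξ} (hH : Measurable H) (hZ : Measurable Z) (hs : Measurable s)
    (hlaw : μ.map s = P) (hind : IndepFun (fun ω => (H ω, Z ω)) s μ)
    (hint : Integrable (fun ω => inner ℝ (H ω) (G (Z ω) (s ω) - gradient f (Z ω))) μ) :
    ∫ ω, inner ℝ (H ω) (G (Z ω) (s ω) - gradient f (Z ω)) ∂μ = 0 := by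
  set φ : (Eucl n × Eucl n) × Ξ → ℝ := fun y => inner ℝ y.1.1 (G y.1.2 y.2 - gradient f y.1.2)
    with hφ
  have hφm : Measurable φ := by
    refine Measurable.inner (measurable_fst.comp measurable_fst) ?_
    exact h.measurable_noise.comp ((measurable_snd.comp measurable_fst).prodMk measurable_snd)
  have hHZ : Measurable (fun ω => (H ω, Z ω)) := hH.prodMk hZ
  have hpair : Measurable (fun ω => ((H ω, Z ω), s ω)) := hHZ.prodMk hs
  have hmap := map_prodMk_eq hHZ hs hlaw hind
  have : IsProbabilityMeasure (μ.map fun ω => (H ω, Z ω)) :=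
    Measure.isProbabilityMeasure_map hHZ.aemeasurable
  have hint' : Integrable φ ((μ.map fun ω => (H ω, Z ω)).prod P) := by
    rw [← hmap]
    exact (integrable_map_measure hφm.aestronglyMeasurable hpair.aemeasurable).2 hint
  have e : ∫ ω, φ ((H ω, Z ω), s ω) ∂μ = ∫ y, φ y ∂((μ.map fun ω => (H ω, Z ω)).prod P) := by
    rw [← hmap, integral_map hpair.aemeasurable hφm.aestronglyMeasurable]
  have hzero : ∀ y : Eucl n × Eucl n, ∫ x, φ (y, x) ∂P = 0 := by
    intro y
    have hi : Integrable (fun x => G y.2 x - gradient f y.2) P :=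
      (h.integrable_G _).sub (integrable_const _)
    have := integral_inner (𝕜 := ℝ) hi y.1
    rw [integral_sub (h.integrable_G _) (integrable_const _), h.unbiased] at this
    simpa using this
  calc ∫ ω, φ ((H ω, Z ω), s ω) ∂μ
      = ∫ y, ∫ x, φ (y, x) ∂P ∂(μ.map fun ω => (H ω, Z ω)) := by rw [e, integral_prod _ hint']
    _ = 0 := by simp [hzero]

/-- Samples within one iteration may depend on each other, so the moment of their weighted sum is
bounded by convexity. -/
lemma sum_noise_moment [IsProbabilityMeasure P] (h : BasicAssumption P f G flow L₁ σ α) (S : Finset ℕ) (c : ℕ → ℝ)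
    {Z : ℕ → Ω → Eucl n} {s : ℕ → Ω → Ξ} (hZ : ∀ t ∈ S, Measurable (Z t))
    (hs : ∀ t ∈ S, Measurable (s t)) (hlaw : ∀ t ∈ S, μ.map (s t) = P)
    (hind : ∀ t ∈ S, IndepFun (Z t) (s t) μ) :
    Integrable (fun ω => ‖∑ t ∈ S, c t • (G (Z t ω) (s t ω) - gradient f (Z t ω))‖ ^ α) μ ∧
      ∫ ω, ‖∑ t ∈ S, c t • (G (Z t ω) (s t ω) - gradient f (Z t ω))‖ ^ α ∂μ
        ≤ (∑ t ∈ S, |c t|) ^ α * σ ^ α := by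
  have h1 := h.one_lt_α
  have hmom := fun t ht => noise_moment h (hZ t ht) (hs t ht) (hlaw t ht) (hind t ht)
  have hC : 0 ≤ ∑ t ∈ S, |c t| := Finset.sum_nonneg fun t _ => abs_nonneg _
  have hpt := fun ω => norm_sum_smul_rpow_le h1 S c
    (fun t => G (Z t ω) (s t ω) - gradient f (Z t ω))
  have hsum : Integrable (fun ω => (∑ t ∈ S, |c t|) ^ (α - 1) *
      ∑ t ∈ S, |c t| * ‖G (Z t ω) (s t ω) - gradient f (Z t ω)‖ ^ α) μ :=
    (integrable_finsetSum S fun t ht => (hmom t ht).1.const_mul _).const_mul _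
  have hmeas : Measurable
      (fun ω => ‖∑ t ∈ S, c t • (G (Z t ω) (s t ω) - gradient f (Z t ω))‖ ^ α) := by
    refine (Finset.measurable_fun_sum S fun t ht => ?_).norm.pow_const α
    exact (h.measurable_noise.comp ((hZ t ht).prodMk (hs t ht))).const_smul (c t)
  have hint : Integrable
      (fun ω => ‖∑ t ∈ S, c t • (G (Z t ω) (s t ω) - gradient f (Z t ω))‖ ^ α) μ := by
    refine hsum.mono' hmeas.aestronglyMeasurable (Filter.Eventually.of_forall fun ω => ?_)
    rw [Real.norm_of_nonneg (by positivity)]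
    exact hpt ω
  refine ⟨hint, (integral_mono hint hsum hpt).trans ?_⟩
  rw [integral_const_mul, integral_finsetSum S fun t ht => (hmom t ht).1.const_mul _]
  calc (∑ t ∈ S, |c t|) ^ (α - 1) *
        ∑ t ∈ S, ∫ ω, |c t| * ‖G (Z t ω) (s t ω) - gradient f (Z t ω)‖ ^ α ∂μ
      ≤ (∑ t ∈ S, |c t|) ^ (α - 1) * ∑ t ∈ S, |c t| * σ ^ α := by
        gcongr with t ht
        rw [integral_const_mul]
        exact mul_le_mul_of_nonneg_left (hmom t ht).2 (abs_nonneg _)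
    _ = (∑ t ∈ S, |c t|) ^ α * σ ^ α := by
        rw [← Finset.sum_mul, ← mul_assoc, ← Real.rpow_add_one' hC (by linarith)]
        congr 2; ring

end Noise

section AddNoise

/-- Adding fresh noise to a vector determined by the past increases the `α`-th moment by at most a
multiple of the `α`-th moment of the noise: the linear term averages out. -/
lemma moment_add_noise_le {n : ℕ} {Ξ : Type*} [MeasurableSpace Ξ] {P : Measure Ξ}
    [IsProbabilityMeasure P] {f : Eucl n → ℝ} {G : Eucl n → Ξ → Eucl n} {flow L₁ σ α : ℝ}
    {Ω : Type*} {m mΩ : MeasurableSpace Ω} {μ : Measure Ω} [IsProbabilityMeasure μ]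
    (h : BasicAssumption P f G flow L₁ σ α) (hm : m ≤ mΩ) (S : Finset ℕ) (c : ℕ → ℝ) {A : Ω → Eucl n} {Z : ℕ → Ω → Eucl n}
    {s : ℕ → Ω → Ξ} (hA : Measurable[m] A) (hZ : ∀ t ∈ S, Measurable[m] (Z t))
    (hs : ∀ t ∈ S, Measurable (s t)) (hlaw : ∀ t ∈ S, μ.map (s t) = P)
    (hind : ∀ t ∈ S, Indep m (MeasurableSpace.comap (s t) inferInstance) μ)
    (hAint : Integrable (fun ω => ‖A ω‖ ^ α) μ) :
    Integrable
      (fun ω => ‖A ω + ∑ t ∈ S, c t • (G (Z t ω) (s t ω) - gradient f (Z t ω))‖ ^ α) μ ∧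
      ∫ ω, ‖A ω + ∑ t ∈ S, c t • (G (Z t ω) (s t ω) - gradient f (Z t ω))‖ ^ α ∂μ
        ≤ ∫ ω, ‖A ω‖ ^ α ∂μ + 6 * ((∑ t ∈ S, |c t|) ^ α * σ ^ α) := by
  have h1 := h.one_lt_α
  have h2 := h.α_le_two
  have hA' : Measurable A := hA.mono hm le_rfl
  have hZ' : ∀ t ∈ S, Measurable (Z t) := fun t ht => (hZ t ht).mono hm le_rfl
  set H : Ω → Eucl n := fun ω => ‖A ω‖ ^ (α - 2) • A ω with hH
  have hHm : Measurable[m] H := @measurable_rpow_smul n Ω m A hA (α - 2)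
  have hH' : Measurable H := hHm.mono hm le_rfl
  have hindZ : ∀ t ∈ S, IndepFun (Z t) (s t) μ := fun t ht =>
    (IndepFun_iff_Indep _ _ _).2 (indep_of_indep_of_le_left (hind t ht) (hZ t ht).comap_le)
  have hindHZ : ∀ t ∈ S, IndepFun (fun ω => (H ω, Z t ω)) (s t) μ := fun t ht =>
    (IndepFun_iff_Indep _ _ _).2
      (indep_of_indep_of_le_left (hind t ht) (Measurable.prodMk hHm (hZ t ht)).comap_le)
  set N : Ω → Eucl n := fun ω => ∑ t ∈ S, c t • (G (Z t ω) (s t ω) - gradient f (Z t ω)) with hN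
  have hnm : ∀ t ∈ S, Measurable (fun ω => G (Z t ω) (s t ω) - gradient f (Z t ω)) :=
    fun t ht => h.measurable_noise.comp ((hZ' t ht).prodMk (hs t ht))
  have hNm : Measurable N :=
    Finset.measurable_fun_sum S fun t ht => (hnm t ht).const_smul (c t)
  obtain ⟨hNint, hNle⟩ : Integrable (fun ω => ‖N ω‖ ^ α) μ ∧
      ∫ ω, ‖N ω‖ ^ α ∂μ ≤ (∑ t ∈ S, |c t|) ^ α * σ ^ α :=
    sum_noise_moment h S c hZ' hs hlaw hindZ
  have hcross : ∀ t ∈ S,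
      Integrable (fun ω => inner ℝ (H ω) (G (Z t ω) (s t ω) - gradient f (Z t ω))) μ := by
    intro t ht
    have hmom := noise_moment h (hZ' t ht) (hs t ht) (hlaw t ht) (hindZ t ht)
    refine (hAint.add hmom.1).mono' (hH'.inner (hnm t ht)).aestronglyMeasurable
      (Filter.Eventually.of_forall fun ω => ?_)
    set v := G (Z t ω) (s t ω) - gradient f (Z t ω)
    have ha := norm_nonneg (A ω)
    have hv := norm_nonneg v
    have hHn : ‖H ω‖ ≤ ‖A ω‖ ^ (α - 1) := by
      rw [hH, norm_smul, Real.norm_of_nonneg (by positivity)]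
      rcases ha.eq_or_lt with h0 | h0
      · rw [← h0, mul_zero]; positivity
      · rw [← Real.rpow_add_one h0.ne']; ring_nf; rfl
    refine (norm_inner_le_norm _ _).trans ?_
    calc ‖H ω‖ * ‖v‖ ≤ ‖A ω‖ ^ (α - 1) * ‖v‖ := by gcongr
      _ ≤ max ‖A ω‖ ‖v‖ ^ (α - 1) * max ‖A ω‖ ‖v‖ := by
          gcongr
          · exact le_max_left _ _
          · exact le_max_right _ _
      _ = max ‖A ω‖ ‖v‖ ^ α := by
          rw [← Real.rpow_add_one' (by positivity) (by linarith)]; congr 1; ring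
      _ ≤ ‖A ω‖ ^ α + ‖v‖ ^ α := by
          have p1 : 0 ≤ ‖A ω‖ ^ α := by positivity
          have p2 : 0 ≤ ‖v‖ ^ α := by positivity
          rcases max_choice ‖A ω‖ ‖v‖ with e | e <;> rw [e] <;> linarith
  have hinner : ∀ ω, inner ℝ (H ω) (N ω)
      = ∑ t ∈ S, c t * inner ℝ (H ω) (G (Z t ω) (s t ω) - gradient f (Z t ω)) := by
    intro ω
    rw [hN, inner_sum]
    exact Finset.sum_congr rfl fun t _ => by rw [inner_smul_right]
  have hcrossN : Integrable (fun ω => inner ℝ (H ω) (N ω)) μ := by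
    simp only [hinner]
    exact integrable_finsetSum S fun t ht => (hcross t ht).const_mul _
  have hzero : ∫ ω, inner ℝ (H ω) (N ω) ∂μ = 0 := by
    simp only [hinner]
    rw [integral_finsetSum S fun t ht => (hcross t ht).const_mul _]
    refine Finset.sum_eq_zero fun t ht => ?_
    rw [integral_const_mul, integral_inner_noise_eq_zero h hH' (hZ' t ht) (hs t ht) (hlaw t ht)
      (hindHZ t ht) (hcross t ht), mul_zero]
  have hpt : ∀ ω, ‖A ω + N ω‖ ^ α ≤ ‖A ω‖ ^ α + α * inner ℝ (H ω) (N ω) + 6 * ‖N ω‖ ^ α := by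
    intro ω
    have := norm_add_rpow_le h1 h2 (A ω) (N ω)
    rwa [mul_assoc α, ← real_inner_smul_left] at this
  have hR' : Integrable (fun ω => ‖A ω‖ ^ α + α * inner ℝ (H ω) (N ω)) μ :=
    hAint.add (hcrossN.const_mul α)
  have hR : Integrable
      (fun ω => ‖A ω‖ ^ α + α * inner ℝ (H ω) (N ω) + 6 * ‖N ω‖ ^ α) μ :=
    hR'.add (hNint.const_mul 6)
  have hL : Integrable (fun ω => ‖A ω + N ω‖ ^ α) μ := by
    refine hR.mono' ((hA'.add hNm).norm.pow_const α).aestronglyMeasurable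
      (Filter.Eventually.of_forall fun ω => ?_)
    rw [Real.norm_of_nonneg (by positivity)]
    exact hpt ω
  refine ⟨hL, (integral_mono hL hR hpt).trans ?_⟩
  rw [integral_add hR' (hNint.const_mul 6),
    integral_add hAint (hcrossN.const_mul α), integral_const_mul, integral_const_mul, hzero]
  linarith

end AddNoise

/-! ### The past of the sampling process -/

section Past

variable {n : ℕ} {Ξ : Type*} [MeasurableSpace Ξ] {Ω : Type*} {P : Measure Ξ} {q : ℕ}
  {ξ : ℕ → ℕ → Ω → Ξ}

/-- The σ-algebra generated by the samples of the iterations before `k`. -/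
abbrev past (q : ℕ) (ξ : ℕ → ℕ → Ω → Ξ) (k : ℕ) : MeasurableSpace Ω :=
  ⨆ j ∈ {j : ℕ | j < k},
    MeasurableSpace.comap (fun (ω : Ω) (t : Finset.Icc 1 q) => ξ j t ω) inferInstance

lemma past_mono {k l : ℕ} (hkl : k ≤ l) : past q ξ k ≤ past q ξ l :=
  biSup_mono fun _ hj => lt_of_lt_of_le hj hkl

lemma past_le_comap (k : ℕ) : past q ξ k ≤
    MeasurableSpace.comap (fun (ω : Ω) (k : ℕ) (t : Finset.Icc 1 q) => ξ k t ω) inferInstance := by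
  refine iSup₂_le fun j _ => ?_
  rw [← measurable_iff_comap_le]
  exact (measurable_pi_apply j).comp
    (comap_measurable (fun (ω : Ω) (k : ℕ) (t : Finset.Icc 1 q) => ξ k t ω))

lemma measurable_past {k t : ℕ} (ht : t ∈ Finset.Icc 1 q) :
    Measurable[past q ξ (k + 1)] (ξ k t) := by
  have h1 : Measurable[MeasurableSpace.comap (fun (ω : Ω) (t : Finset.Icc 1 q) => ξ k t ω)
      inferInstance] (ξ k t) :=
    (measurable_pi_apply (⟨t, ht⟩ : Finset.Icc 1 q)).comp
      (comap_measurable (fun (ω : Ω) (t : Finset.Icc 1 q) => ξ k t ω))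
  exact h1.mono (le_iSup₂_of_le k (Nat.lt_succ_self k) le_rfl) le_rfl

variable [mΩ : MeasurableSpace Ω] {μ : Measure Ω}

lemma IsSampling.measurable_tuple (h : IsSampling μ P q ξ) (k : ℕ) :
    Measurable (fun (ω : Ω) (t : Finset.Icc 1 q) => ξ k t ω) :=
  measurable_pi_lambda _ fun t => h.measurable k t t.2

lemma IsSampling.past_le (h : IsSampling μ P q ξ) (k : ℕ) : past q ξ k ≤ mΩ :=
  iSup₂_le fun j _ => (h.measurable_tuple j).comap_le

lemma IsSampling.indep_past (h : IsSampling μ P q ξ) {k t : ℕ} (ht : t ∈ Finset.Icc 1 q) :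
    Indep (past q ξ k) (MeasurableSpace.comap (ξ k t) inferInstance) μ := by
  have h1 := indep_iSup_of_disjoint (fun j => (h.measurable_tuple j).comap_le) h.indep.iIndep
    (S := {j : ℕ | j < k}) (T := {k}) (by simp)
  refine indep_of_indep_of_le_right h1 ?_
  simp only [Set.mem_singleton_iff, iSup_iSup_eq_left]
  rw [← measurable_iff_comap_le]
  exact (measurable_pi_apply (⟨t, ht⟩ : Finset.Icc 1 q)).comp
    (comap_measurable (fun (ω : Ω) (t : Finset.Icc 1 q) => ξ k t ω))

end Past

/-! ### Measurability of the iterates -/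

section Measurability

variable {n : ℕ} {Ξ : Type*} [MeasurableSpace Ξ] {Ω : Type*} {G : Eucl n → Ξ → Eucl n}
  {x₀ : Eucl n} {q : ℕ} {η : ℕ → ℝ} {γ θ : ℕ → ℕ → ℝ} {ξ : ℕ → ℕ → Ω → Ξ}

lemma measurable_extrapolate [MeasurableSpace Ω] {S : Ω → State n} (k t : ℕ)
    (h1 : Measurable fun ω => (S ω).x) (h2 : Measurable fun ω => (S ω).xPrev) :
    Measurable fun ω => extrapolate γ k t (S ω) :=
  h1.add (Measurable.const_smul (h1.sub h2) ((1 - prevGamma γ k t) / prevGamma γ k t))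

lemma measurable_direction [MeasurableSpace Ω] (hG : Measurable fun y : Eucl n × Ξ => G y.1 y.2)
    {S : Ω → State n} {s : ℕ → Ω → Ξ} (k : ℕ) (h1 : Measurable fun ω => (S ω).x)
    (h2 : Measurable fun ω => (S ω).xPrev) (h3 : Measurable fun ω => (S ω).mPrev)
    (hs : ∀ t ∈ Finset.Icc 1 q, Measurable (s t)) :
    Measurable fun ω => direction G q γ θ k (S ω) fun t => s t ω := by
  refine (h3.const_smul (1 - ∑ t ∈ Finset.Icc 1 q, prevTheta q θ k t)).add
    (Finset.measurable_fun_sum _ fun t ht => ?_)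
  exact (hG.comp ((measurable_extrapolate k t h1 h2).prodMk (hs t ht))).const_smul
    (prevTheta q θ k t)

lemma measurable_normalized_step [MeasurableSpace Ω] {x m : Ω → Eucl n} (hx : Measurable x)
    (hm : Measurable m) (c : ℝ) : Measurable fun ω => x ω - c • (‖m ω‖⁻¹ • m ω) :=
  hx.sub ((hm.norm.inv.smul hm).const_smul c)

/-- When iteration `k` begins, the memory of the method is determined by the earlier samples. -/
lemma measurable_state (hG : Measurable fun y : Eucl n × Ξ => G y.1 y.2) (k : ℕ) :
    Measurable[past q ξ k] (fun ω => (state G x₀ q η γ θ (fun j t => ξ j t ω) k).x) ∧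
    Measurable[past q ξ k] (fun ω => (state G x₀ q η γ θ (fun j t => ξ j t ω) k).xPrev) ∧
    Measurable[past q ξ k] (fun ω => (state G x₀ q η γ θ (fun j t => ξ j t ω) k).mPrev) := by
  induction k with
  | zero => refine ⟨?_, ?_, ?_⟩ <;> exact @measurable_const _ _ _ (past q ξ 0) _
  | succ k ih =>
    have hle := past_mono (q := q) (ξ := ξ) (Nat.le_succ k)
    have h1 := ih.1.mono hle le_rfl
    have h2 := ih.2.1.mono hle le_rfl
    have h3 := ih.2.2.mono hle le_rfl
    have hd := @measurable_direction n Ξ _ Ω G q γ θ (past q ξ (k + 1)) hG _ (fun t => ξ k t) k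
      h1 h2 h3 (fun t ht => measurable_past ht)
    exact ⟨@measurable_normalized_step n Ω (past q ξ (k + 1)) _ _ h1 hd (η k), h1, hd⟩

end Measurability

/-! ### The error of the momentum along a run -/

section Run

variable {n : ℕ} {Ξ : Type*}

/-- The memory of the method after `k` iterations, for the prescribed parameters. -/
noncomputable def run (G : Eucl n → Ξ → Eucl n) (x₀ : Eucl n) (p : ℕ) (s : ℕ → ℕ → Ξ) (k : ℕ) :
    State n :=
  state G x₀ (p - 1) (eta p) (gammaT p) (theta p) s k

/-- The error `m^k - ∇f(x^k)` of the search direction; `m^k` is remembered by the state `k + 1`. -/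
noncomputable def err (f : Eucl n → ℝ) (G : Eucl n → Ξ → Eucl n) (x₀ : Eucl n) (p : ℕ)
    (s : ℕ → ℕ → Ξ) (k : ℕ) : Eucl n :=
  (run G x₀ p s (k + 1)).mPrev - gradient f (run G x₀ p s k).x

/-- The point at which the `t`-th stochastic gradient of iteration `k + 1` is taken. -/
noncomputable def node (G : Eucl n → Ξ → Eucl n) (x₀ : Eucl n) (p : ℕ) (s : ℕ → ℕ → Ξ) (k t : ℕ) :
    Eucl n :=
  extrapolate (gammaT p) (k + 1) t (run G x₀ p s (k + 1))

/-- The part of the error of `m^{k+1}` that is known before the samples of iteration `k + 1` are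
drawn: the damped previous error and the bias of the extrapolated gradients. -/
noncomputable def predErr (f : Eucl n → ℝ) (G : Eucl n → Ξ → Eucl n) (x₀ : Eucl n) (p : ℕ)
    (s : ℕ → ℕ → Ξ) (k : ℕ) : Eucl n :=
  (1 - ∑ t ∈ Finset.Icc 1 (p - 1), theta p k t) • err f G x₀ p s k +
    ((1 - ∑ t ∈ Finset.Icc 1 (p - 1), theta p k t) • gradient f (run G x₀ p s k).x +
      ∑ t ∈ Finset.Icc 1 (p - 1), theta p k t • gradient f (node G x₀ p s k t) -
      gradient f (run G x₀ p s (k + 1)).x)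

variable {f : Eucl n → ℝ} {G : Eucl n → Ξ → Eucl n} {x₀ : Eucl n} {p : ℕ} {s : ℕ → ℕ → Ξ}

lemma run_succ_x (k : ℕ) : (run G x₀ p s (k + 1)).x = (run G x₀ p s k).x -
    eta p k • (‖(run G x₀ p s (k + 1)).mPrev‖⁻¹ • (run G x₀ p s (k + 1)).mPrev) := rfl

lemma norm_run_succ_x_sub_le (k : ℕ) :
    ‖(run G x₀ p s (k + 1)).x - (run G x₀ p s k).x‖ ≤ eta p k := by
  rw [run_succ_x, sub_sub_cancel_left, norm_neg, norm_smul, norm_smul, norm_inv, norm_norm,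
    Real.norm_of_nonneg (eta_pos p k).le]
  exact mul_le_of_le_one_right (eta_pos p k).le (inv_mul_le_one)

lemma eta_le_one (p k : ℕ) : eta p k ≤ 1 := by
  have hk : (0 : ℝ) ≤ k := k.cast_nonneg
  rw [eta_eq]
  exact Real.rpow_le_one_of_one_le_of_nonpos (by linarith) (neg_nonpos.2 (by positivity))

lemma norm_run_x_sub_le (k : ℕ) : ‖(run G x₀ p s k).x - x₀‖ ≤ k := by
  induction k with
  | zero => simp [run, state]
  | succ k ih =>
    calc ‖(run G x₀ p s (k + 1)).x - x₀‖
        = ‖((run G x₀ p s (k + 1)).x - (run G x₀ p s k).x) + ((run G x₀ p s k).x - x₀)‖ := by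
          congr 1; abel
      _ ≤ 1 + k :=
          (norm_add_le _ _).trans
            (add_le_add ((norm_run_succ_x_sub_le k).trans (eta_le_one p k)) ih)
      _ = ((k + 1 : ℕ) : ℝ) := by push_cast; ring

lemma err_zero (hp : 2 ≤ p) : err f G x₀ p s 0 =
    ∑ t ∈ Finset.Icc 1 (p - 1), (1 / ((p - 1 : ℕ) : ℝ)) • (G x₀ (s 0 t) - gradient f x₀) := by
  have hq : ((p - 1 : ℕ) : ℝ) ≠ 0 := by
    have : p - 1 ≠ 0 := by omega
    exact_mod_cast this
  simp only [smul_sub, Finset.sum_sub_distrib]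
  have h : ∑ _t ∈ Finset.Icc 1 (p - 1), (1 / ((p - 1 : ℕ) : ℝ)) • gradient f x₀
      = gradient f x₀ := by
    rw [Finset.sum_const, Nat.card_Icc, Nat.add_sub_cancel, ← Nat.cast_smul_eq_nsmul ℝ, smul_smul,
      mul_one_div_cancel hq, one_smul]
  rw [h]
  simp [err, run, state, direction, extrapolate, prevTheta]

lemma err_succ (k : ℕ) : err f G x₀ p s (k + 1) = predErr f G x₀ p s k +
    ∑ t ∈ Finset.Icc 1 (p - 1), theta p k t •
      (G (node G x₀ p s k t) (s (k + 1) t) - gradient f (node G x₀ p s k t)) := by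
  have h : (run G x₀ p s (k + 1 + 1)).mPrev
      = (1 - ∑ t ∈ Finset.Icc 1 (p - 1), theta p k t) • (run G x₀ p s (k + 1)).mPrev +
        ∑ t ∈ Finset.Icc 1 (p - 1), theta p k t • G (node G x₀ p s k t) (s (k + 1) t) := rfl
  rw [predErr, err, h, err]
  simp only [smul_sub, Finset.sum_sub_distrib]
  abel

lemma node_eq (k : ℕ) {t : ℕ} (ht : 1 ≤ t) : node G x₀ p s k t = (run G x₀ p s k).x +
    ((t : ℝ) ^ 2 / gamma p k) • ((run G x₀ p s (k + 1)).x - (run G x₀ p s k).x) := by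
  have h : node G x₀ p s k t = (run G x₀ p s (k + 1)).x +
      ((1 - gammaT p k t) / gammaT p k t) •
        ((run G x₀ p s (k + 1)).x - (run G x₀ p s k).x) := rfl
  have ht' : (0 : ℝ) < t := by exact_mod_cast ht
  have hγ := gamma_pos p k
  have e : (1 - gammaT p k t) / gammaT p k t = (t : ℝ) ^ 2 / gamma p k - 1 := by
    rw [gammaT]; field_simp
  rw [h, e, sub_smul, one_smul]
  abel

/-- The constant in the bound for the bias of the extrapolated gradients. -/
noncomputable def biasConst (p : ℕ) (Lp : ℝ) : ℝ := 3 * (p : ℝ) ^ (2 * p) * Lp / p.factorial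

lemma norm_bias_le {Lp : ℝ} (h : HighSmoothAssumption f p Lp) (k : ℕ) :
    ‖(1 - ∑ t ∈ Finset.Icc 1 (p - 1), theta p k t) • gradient f (run G x₀ p s k).x +
      ∑ t ∈ Finset.Icc 1 (p - 1), theta p k t • gradient f (node G x₀ p s k t) -
      gradient f (run G x₀ p s (k + 1)).x‖
      ≤ biasConst p Lp * (eta p k ^ p * (gamma p k ^ (p - 1))⁻¹) := by
  have hγ := gamma_pos p k
  have hγ1 := gamma_le_one p k
  have hLp := h.Lp_pos
  have key := norm_extrapolated_gradient_sub_le h (Finset.Icc 1 (p - 1)) (theta p k)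
    (fun t => (t : ℝ) ^ 2 / gamma p k) (fun t _ => by positivity)
    (fun j h1 h2 => by
      simp only [theta_eq_weight]; exact sum_weight_mul_node_pow hγ h1 h2)
    (run G x₀ p s k).x ((run G x₀ p s (k + 1)).x - (run G x₀ p s k).x)
  rw [add_sub_cancel] at key
  have hnode : ∑ t ∈ Finset.Icc 1 (p - 1), theta p k t • gradient f (node G x₀ p s k t)
      = ∑ t ∈ Finset.Icc 1 (p - 1), theta p k t • gradient f ((run G x₀ p s k).x +
        ((t : ℝ) ^ 2 / gamma p k) • ((run G x₀ p s (k + 1)).x - (run G x₀ p s k).x)) :=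
    Finset.sum_congr rfl fun t ht => by rw [node_eq k (Finset.mem_Icc.1 ht).1]
  rw [hnode]
  refine key.trans ?_
  have h1 := one_add_sum_abs_weight_mul_node_pow_le h.two_le_p hγ hγ1
  have h2 := norm_run_succ_x_sub_le (G := G) (x₀ := x₀) (p := p) (s := s) k
  calc _ ≤ Lp * eta p k ^ p / p.factorial * (3 * (p : ℝ) ^ (2 * p) * (gamma p k ^ (p - 1))⁻¹) := by
        have hη := eta_pos p k
        exact mul_le_mul (by gcongr) h1 (by positivity) (by positivity)
    _ = _ := by rw [biasConst]; ring

lemma norm_predErr_rpow_le {Lp α : ℝ} (h : HighSmoothAssumption f p Lp) (h1 : 1 < α) (k : ℕ) :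
    ‖predErr f G x₀ p s k‖ ^ α ≤ (1 - gamma p k) * ‖err f G x₀ p s k‖ ^ α +
      gamma p k ^ (1 - α) *
        (biasConst p Lp * (eta p k ^ p * (gamma p k ^ (p - 1))⁻¹)) ^ α := by
  have hγ := gamma_pos p k
  have hγ1 := gamma_le_one p k
  have hp := h.two_le_p
  have hle : gamma p k ≤ ∑ t ∈ Finset.Icc 1 (p - 1), theta p k t := by
    simp only [theta_eq_weight]; exact le_sum_weight (by omega) hγ hγ1
  have hone : ∑ t ∈ Finset.Icc 1 (p - 1), theta p k t ≤ 1 := by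
    have := one_sub_sum_weight_nonneg (q := p - 1) hγ hγ1
    simp only [theta_eq_weight]; linarith
  have hb := norm_bias_le (G := G) (x₀ := x₀) (s := s) h k
  refine (norm_smul_add_rpow_le h1 (hγ.trans_le hle) hone _ _).trans ?_
  have hpow := Real.rpow_le_rpow_of_nonpos hγ hle (show 1 - α ≤ 0 by linarith)
  have hb' := Real.rpow_le_rpow (norm_nonneg _) hb (show 0 ≤ α by linarith)
  gcongr

end Run

/-! ### Moments of the error and the potential -/

section Moments

variable {n : ℕ} {Ξ : Type*} [MeasurableSpace Ξ] {P : Measure Ξ}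
  {f : Eucl n → ℝ} {G : Eucl n → Ξ → Eucl n} {flow L₁ σ α : ℝ} {p : ℕ} {Lp : ℝ}
  {Ω : Type*} {ξ : ℕ → ℕ → Ω → Ξ} {x₀ : Eucl n}

lemma measurable_run (hG : Measurable fun y : Eucl n × Ξ => G y.1 y.2) (k : ℕ) :
    Measurable[past (p - 1) ξ k] (fun ω => (run G x₀ p (fun j t => ξ j t ω) k).x) ∧
    Measurable[past (p - 1) ξ k] (fun ω => (run G x₀ p (fun j t => ξ j t ω) k).xPrev) ∧
    Measurable[past (p - 1) ξ k] (fun ω => (run G x₀ p (fun j t => ξ j t ω) k).mPrev) :=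
  measurable_state hG k

lemma measurable_predErr_of [MeasurableSpace Ω] {c : ℝ} {θ : ℕ → ℝ} {S : Finset ℕ}
    {M X Y : Ω → Eucl n} {Z : ℕ → Ω → Eucl n} (hg : Measurable (gradient f)) (hM : Measurable M)
    (hX : Measurable X) (hY : Measurable Y) (hZ : ∀ t ∈ S, Measurable (Z t)) :
    Measurable fun ω => c • (M ω - gradient f (X ω)) +
      (c • gradient f (X ω) + ∑ t ∈ S, θ t • gradient f (Z t ω) - gradient f (Y ω)) := by
  have h1 : Measurable fun ω => ∑ t ∈ S, θ t • gradient f (Z t ω) :=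
    Finset.measurable_fun_sum _ fun t ht => (hg.comp (hZ t ht)).const_smul (θ t)
  exact ((hM.sub (hg.comp hX)).const_smul c).add
    ((((hg.comp hX).const_smul c).add h1).sub (hg.comp hY))

lemma measurable_node (hG : Measurable fun y : Eucl n × Ξ => G y.1 y.2) (k t : ℕ) :
    Measurable[past (p - 1) ξ (k + 1)] (fun ω => node G x₀ p (fun j t => ξ j t ω) k t) :=
  @measurable_extrapolate n Ω (gammaT p) (past (p - 1) ξ (k + 1)) _ (k + 1) t
    (measurable_run hG (k + 1)).1 (measurable_run hG (k + 1)).2.1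

lemma measurable_predErr (h : BasicAssumption P f G flow L₁ σ α) (k : ℕ) :
    Measurable[past (p - 1) ξ (k + 1)] (fun ω => predErr f G x₀ p (fun j t => ξ j t ω) k) :=
  @measurable_predErr_of n f Ω (past (p - 1) ξ (k + 1)) _ _ _ _ _ _ _ h.continuous_gradient.measurable (measurable_run h.measurable_G (k + 1)).2.2
    ((measurable_run h.measurable_G k).1.mono (past_mono (Nat.le_succ k)) le_rfl)
    (measurable_run h.measurable_G (k + 1)).1 (fun t _ => measurable_node h.measurable_G k t)

lemma norm_gradient_run_le (h : BasicAssumption P f G flow L₁ σ α) (s : ℕ → ℕ → Ξ) (k : ℕ) :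
    ‖gradient f (run G x₀ p s k).x‖ ≤ ‖gradient f x₀‖ + L₁ * k := by
  calc ‖gradient f (run G x₀ p s k).x‖
      ≤ ‖gradient f x₀‖ + ‖gradient f (run G x₀ p s k).x - gradient f x₀‖ := norm_le_insert' _ _
    _ ≤ _ := by
        gcongr
        refine (h.lipschitz_gradient _ _).trans ?_
        have := h.L₁_pos
        gcongr
        exact norm_run_x_sub_le k

variable [mΩ : MeasurableSpace Ω] {μ : Measure Ω}

lemma measurable_run_x (h : BasicAssumption P f G flow L₁ σ α) (hξ : IsSampling μ P (p - 1) ξ)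
    (k : ℕ) : Measurable (fun ω => (run G x₀ p (fun j t => ξ j t ω) k).x) :=
  (measurable_run h.measurable_G k).1.mono (hξ.past_le k) le_rfl

variable [IsProbabilityMeasure μ]

lemma moment_err_zero [IsProbabilityMeasure P] (h : BasicAssumption P f G flow L₁ σ α) (hp : 2 ≤ p)
    (hξ : IsSampling μ P (p - 1) ξ) :
    Integrable (fun ω => ‖err f G x₀ p (fun j t => ξ j t ω) 0‖ ^ α) μ ∧
      ∫ ω, ‖err f G x₀ p (fun j t => ξ j t ω) 0‖ ^ α ∂μ ≤ σ ^ α := by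
  have hq : ((p - 1 : ℕ) : ℝ) ≠ 0 := by
    have : p - 1 ≠ 0 := by omega
    exact_mod_cast this
  have key := sum_noise_moment (μ := μ) h (Finset.Icc 1 (p - 1)) (fun _ => 1 / ((p - 1 : ℕ) : ℝ))
    (Z := fun _ _ => x₀) (s := fun t => ξ 0 t) (fun _ _ => measurable_const) (hξ.measurable 0)
    (hξ.law 0) (fun _ _ => indepFun_const_left _ _)
  have hsum : ∑ _t ∈ Finset.Icc 1 (p - 1), |1 / ((p - 1 : ℕ) : ℝ)| = 1 := by
    rw [Finset.sum_const, Nat.card_Icc, Nat.add_sub_cancel, nsmul_eq_mul,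
      abs_of_nonneg (by positivity), mul_one_div_cancel hq]
  rw [hsum, Real.one_rpow, one_mul] at key
  simpa only [err_zero hp] using key

/-- The recursion for the moments of the error. -/
lemma moment_err_succ [IsProbabilityMeasure P] (h : BasicAssumption P f G flow L₁ σ α) (hs : HighSmoothAssumption f p Lp)
    (hξ : IsSampling μ P (p - 1) ξ) (k : ℕ)
    (hint : Integrable (fun ω => ‖err f G x₀ p (fun j t => ξ j t ω) k‖ ^ α) μ) :
    Integrable (fun ω => ‖err f G x₀ p (fun j t => ξ j t ω) (k + 1)‖ ^ α) μ ∧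
      ∫ ω, ‖err f G x₀ p (fun j t => ξ j t ω) (k + 1)‖ ^ α ∂μ
        ≤ (1 - gamma p k) * ∫ ω, ‖err f G x₀ p (fun j t => ξ j t ω) k‖ ^ α ∂μ +
          gamma p k ^ (1 - α) *
            (biasConst p Lp * (eta p k ^ p * (gamma p k ^ (p - 1))⁻¹)) ^ α +
          6 * ((2 * ((p - 1 : ℕ) : ℝ) * gamma p k) ^ α * σ ^ α) := by
  have h1 := h.one_lt_α
  have hγ := gamma_pos p k
  have hγ1 := gamma_le_one p k
  have hpt := fun ω => norm_predErr_rpow_le (G := G) (x₀ := x₀) (s := fun j t => ξ j t ω) hs h1 k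
  have hR : Integrable (fun ω => (1 - gamma p k) * ‖err f G x₀ p (fun j t => ξ j t ω) k‖ ^ α +
      gamma p k ^ (1 - α) *
        (biasConst p Lp * (eta p k ^ p * (gamma p k ^ (p - 1))⁻¹)) ^ α) μ :=
    (hint.const_mul _).add (integrable_const _)
  have hm := measurable_predErr (p := p) (ξ := ξ) (x₀ := x₀) h k
  have hA : Integrable (fun ω => ‖predErr f G x₀ p (fun j t => ξ j t ω) k‖ ^ α) μ := by
    refine hR.mono' ((hm.mono (hξ.past_le _) le_rfl).norm.pow_const α).aestronglyMeasurable
      (Filter.Eventually.of_forall fun ω => ?_)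
    rw [Real.norm_of_nonneg (by positivity)]
    exact hpt ω
  have key := moment_add_noise_le (μ := μ) h (hξ.past_le (k + 1)) (Finset.Icc 1 (p - 1))
    (theta p k) (Z := fun t ω => node G x₀ p (fun j t => ξ j t ω) k t)
    (s := fun t => ξ (k + 1) t) hm
    (fun t _ => measurable_node h.measurable_G k t) (hξ.measurable (k + 1)) (hξ.law (k + 1))
    (fun t ht => hξ.indep_past ht) hA
  simp only [← err_succ] at key
  refine ⟨key.1, key.2.trans (add_le_add ((integral_mono hA hR hpt).trans (le_of_eq ?_)) ?_)⟩
  · rw [integral_add (hint.const_mul _) (integrable_const _), integral_const_mul]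
    simp
  · have hθ : ∑ t ∈ Finset.Icc 1 (p - 1), |theta p k t| ≤ 2 * ((p - 1 : ℕ) : ℝ) * gamma p k := by
      simp only [theta_eq_weight]; exact sum_abs_weight_le hγ hγ1
    have hσ := h.σ_pos
    have h0 : 0 ≤ ∑ t ∈ Finset.Icc 1 (p - 1), |theta p k t| :=
      Finset.sum_nonneg fun t _ => abs_nonneg _
    gcongr

lemma integrable_err [IsProbabilityMeasure P] (h : BasicAssumption P f G flow L₁ σ α) (hs : HighSmoothAssumption f p Lp)
    (hξ : IsSampling μ P (p - 1) ξ) (k : ℕ) :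
    Integrable (fun ω => ‖err f G x₀ p (fun j t => ξ j t ω) k‖ ^ α) μ := by
  induction k with
  | zero => exact (moment_err_zero h hs.two_le_p hξ).1
  | succ k ih => exact (moment_err_succ h hs hξ k ih).1

lemma integrable_norm_gradient (h : BasicAssumption P f G flow L₁ σ α)
    (hξ : IsSampling μ P (p - 1) ξ) (k : ℕ) :
    Integrable (fun ω => ‖gradient f (run G x₀ p (fun j t => ξ j t ω) k).x‖) μ := by
  refine Integrable.of_bound (C := ‖gradient f x₀‖ + L₁ * k)
    (h.continuous_gradient.measurable.comp
      (measurable_run_x h hξ k)).norm.aestronglyMeasurable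
    (Filter.Eventually.of_forall fun ω => ?_)
  rw [norm_norm]
  exact norm_gradient_run_le h _ k

/-- The iterates stay at bounded distance from `x₀`, where `f` is bounded. -/
lemma integrable_value (h : BasicAssumption P f G flow L₁ σ α)
    (hξ : IsSampling μ P (p - 1) ξ) (k : ℕ) :
    Integrable (fun ω => f (run G x₀ p (fun j t => ξ j t ω) k).x) μ := by
  have hL₁ := h.L₁_pos
  refine Integrable.of_bound
    (C := max (f x₀ + ‖gradient f x₀‖ * k + L₁ / 2 * (k : ℝ) ^ 2) (-flow))
    (h.contDiff.continuous.measurable.comp (measurable_run_x h hξ k)).aestronglyMeasurable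
    (Filter.Eventually.of_forall fun ω => ?_)
  set y := (run G x₀ p (fun j t => ξ j t ω) k).x with hy
  have hd : ‖y - x₀‖ ≤ k := norm_run_x_sub_le k
  have hup := le_add_inner_gradient h.contDiff h.lipschitz_gradient x₀ (y - x₀)
  rw [add_sub_cancel] at hup
  have hin : inner ℝ (gradient f x₀) (y - x₀) ≤ ‖gradient f x₀‖ * k :=
    (real_inner_le_norm _ _).trans (by gcongr)
  have hsq : L₁ / 2 * ‖y - x₀‖ ^ 2 ≤ L₁ / 2 * (k : ℝ) ^ 2 := by gcongr
  rw [Real.norm_eq_abs]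
  refine abs_le.2 ⟨?_, le_max_of_le_left (by linarith)⟩
  have := le_max_right (f x₀ + ‖gradient f x₀‖ * k + L₁ / 2 * (k : ℝ) ^ 2) (-flow)
  have := h.lower_bound y
  linarith

/-- The constant in Young's inequality when the `α`-th power carries a factor `1 / 30`. -/
noncomputable def youngConst (α : ℝ) : ℝ :=
  (30 : ℝ) ^ (1 / (α - 1)) * (α - 1) * (2 / α) ^ (α / (α - 1))

/-- The potential `f(x^k) + w_k ‖m^k - ∇f(x^k)‖ ^ α` decreases on average by `η_k ‖∇f(x^k)‖`, up to
two sequences that are almost summable. -/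
lemma potential_step [IsProbabilityMeasure P] (h : BasicAssumption P f G flow L₁ σ α)
    (hs : HighSmoothAssumption f p Lp) (hξ : IsSampling μ P (p - 1) ξ) (k : ℕ) :
    ∫ ω, f (run G x₀ p (fun j t => ξ j t ω) (k + 1)).x ∂μ +
        potWeight p α (k + 1) * ∫ ω, ‖err f G x₀ p (fun j t => ξ j t ω) (k + 1)‖ ^ α ∂μ +
        eta p k * ∫ ω, ‖gradient f (run G x₀ p (fun j t => ξ j t ω) k).x‖ ∂μ
      ≤ ∫ ω, f (run G x₀ p (fun j t => ξ j t ω) k).x ∂μ +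
        potWeight p α k * ∫ ω, ‖err f G x₀ p (fun j t => ξ j t ω) k‖ ^ α ∂μ +
        (L₁ / 2 + 2 * biasConst p Lp ^ α) * ((k : ℝ) + 4)⁻¹ +
        (youngConst α + 12 * ((2 * ((p - 1 : ℕ) : ℝ)) ^ α * σ ^ α)) *
          ((k : ℝ) + 4) ^ (-1 + noiseExp p α) := by
  have h1 := h.one_lt_α
  have h2 := h.α_le_two
  have hL₁ := h.L₁_pos
  have hσ := h.σ_pos
  have hLp := hs.Lp_pos
  have hη := eta_pos p k
  have hγ := gamma_pos p k
  have hγ1 := gamma_le_one p k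
  have hw := potWeight_pos p α k
  have hp := hs.two_le_p
  have hE0 : 0 ≤ ∫ ω, ‖err f G x₀ p (fun j t => ξ j t ω) k‖ ^ α ∂μ :=
    integral_nonneg fun ω => by positivity
  have hD : 0 ≤ biasConst p Lp := by unfold biasConst; positivity
  have hE := integrable_err (x₀ := x₀) h hs hξ k
  have hF := integrable_value (x₀ := x₀) h hξ k
  have hg := integrable_norm_gradient (x₀ := x₀) h hξ k
  -- descent of the function values, with the error absorbed by Young's inequality
  have hdescent : ∀ ω, f (run G x₀ p (fun j t => ξ j t ω) (k + 1)).x ≤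
      f (run G x₀ p (fun j t => ξ j t ω) k).x -
        eta p k * ‖gradient f (run G x₀ p (fun j t => ξ j t ω) k).x‖ +
        potWeight p α k * gamma p k / 30 * ‖err f G x₀ p (fun j t => ξ j t ω) k‖ ^ α +
        (youngConst α * ((k : ℝ) + 4) ^ (-1 + noiseExp p α) + L₁ / 2 * ((k : ℝ) + 4)⁻¹) := by
    intro ω
    have hd := descent_step h.contDiff hL₁ h.lipschitz_gradient
      (run G x₀ p (fun j t => ξ j t ω) k).x (run G x₀ p (fun j t => ξ j t ω) (k + 1)).mPrev hη
    rw [← run_succ_x] at hd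
    have hy := two_mul_mul_le_rpow_add h1 hη
      (show 0 < potWeight p α k * gamma p k / 30 by positivity)
      (norm_nonneg (err f G x₀ p (fun j t => ξ j t ω) k))
    have hyc : (α - 1) * (2 / α) ^ (α / (α - 1)) * (eta p k ^ (α / (α - 1)) *
        (potWeight p α k * gamma p k / 30) ^ (-(1 / (α - 1))))
        = youngConst α * ((k : ℝ) + 4) ^ (-1 + noiseExp p α) := by
      rw [← eta_rpow_mul_potWeight_rpow h1, youngConst, Real.div_rpow
          (show 0 ≤ potWeight p α k * gamma p k by positivity) (show (0 : ℝ) ≤ 30 by norm_num),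
        Real.rpow_neg (show (0 : ℝ) ≤ 30 by norm_num), div_inv_eq_mul]
      ring
    rw [hyc] at hy
    have hsq : L₁ / 2 * eta p k ^ 2 ≤ L₁ / 2 * ((k : ℝ) + 4)⁻¹ := by
      gcongr
      exact eta_sq_le p k
    have he : ‖err f G x₀ p (fun j t => ξ j t ω) k‖
        = ‖(run G x₀ p (fun j t => ξ j t ω) (k + 1)).mPrev -
          gradient f (run G x₀ p (fun j t => ξ j t ω) k).x‖ := rfl
    rw [← he] at hd
    linarith
  have i1 : Integrable (fun ω => f (run G x₀ p (fun j t => ξ j t ω) k).x -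
      eta p k * ‖gradient f (run G x₀ p (fun j t => ξ j t ω) k).x‖) μ := hF.sub (hg.const_mul _)
  have i2 : Integrable (fun ω => f (run G x₀ p (fun j t => ξ j t ω) k).x -
      eta p k * ‖gradient f (run G x₀ p (fun j t => ξ j t ω) k).x‖ +
      potWeight p α k * gamma p k / 30 * ‖err f G x₀ p (fun j t => ξ j t ω) k‖ ^ α) μ :=
    i1.add (hE.const_mul _)
  have hF' := integral_mono (integrable_value (x₀ := x₀) h hξ (k + 1))
    (i2.add (integrable_const _)) hdescent
  simp only [Pi.add_apply] at hF'
  rw [integral_add i2 (integrable_const _), integral_add i1 (hE.const_mul _),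
    integral_sub hF (hg.const_mul _), integral_const_mul, integral_const_mul, integral_const] at hF'
  simp only [probReal_univ, one_smul] at hF'
  -- growth of the weighted error
  have hErec := (moment_err_succ (x₀ := x₀) h hs hξ k hE).2
  set E := ∫ ω, ‖err f G x₀ p (fun j t => ξ j t ω) k‖ ^ α ∂μ
  have hw1 := potWeight_pos p α (k + 1)
  have hbias : potWeight p α (k + 1) * (gamma p k ^ (1 - α) *
      (biasConst p Lp * (eta p k ^ p * (gamma p k ^ (p - 1))⁻¹)) ^ α)
      ≤ 2 * biasConst p Lp ^ α * ((k : ℝ) + 4)⁻¹ := by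
    have hb := potWeight_mul_bias_le (by omega : 1 ≤ p) h1 h2 k
    rw [Real.mul_rpow hD (by positivity)]
    calc _ ≤ 2 * potWeight p α k * (gamma p k ^ (1 - α) *
          (biasConst p Lp ^ α * (eta p k ^ p * (gamma p k ^ (p - 1))⁻¹) ^ α)) := by
          gcongr; exact potWeight_succ_le_two_mul h1 h2 k
      _ = 2 * biasConst p Lp ^ α * (potWeight p α k * (gamma p k ^ (1 - α) *
          (eta p k ^ p * (gamma p k ^ (p - 1))⁻¹) ^ α)) := by ring
      _ ≤ _ := by gcongr
  have hnoise : potWeight p α (k + 1) *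
      (6 * ((2 * ((p - 1 : ℕ) : ℝ) * gamma p k) ^ α * σ ^ α))
      ≤ 12 * ((2 * ((p - 1 : ℕ) : ℝ)) ^ α * σ ^ α) * ((k : ℝ) + 4) ^ (-1 + noiseExp p α) := by
    rw [← potWeight_mul_gamma_rpow h1, Real.mul_rpow (by positivity) hγ.le]
    calc _ ≤ 2 * potWeight p α k *
          (6 * ((2 * ((p - 1 : ℕ) : ℝ)) ^ α * gamma p k ^ α * σ ^ α)) := by
          gcongr; exact potWeight_succ_le_two_mul h1 h2 k
      _ = _ := by ring
  have hdamp : potWeight p α (k + 1) * ((1 - gamma p k) * E)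
      ≤ potWeight p α k * (1 - gamma p k / 30) * E := by
    rw [← mul_assoc]
    exact mul_le_mul_of_nonneg_right (potWeight_succ_mul_le h1 h2 k) hE0
  have hE' := mul_le_mul_of_nonneg_left hErec hw1.le
  rw [mul_add, mul_add] at hE'
  linarith

/-- Summing the decrease of the potential. -/
lemma sum_eta_mul_gradient_le [IsProbabilityMeasure P] (h : BasicAssumption P f G flow L₁ σ α)
    (hs : HighSmoothAssumption f p Lp) (hξ : IsSampling μ P (p - 1) ξ) (K : ℕ) :
    ∑ k ∈ Finset.range K,
        eta p k * ∫ ω, ‖gradient f (run G x₀ p (fun j t => ξ j t ω) k).x‖ ∂μ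
      ≤ f x₀ - flow + (4 : ℝ) ^ ((1 : ℝ) / 3) * σ ^ α +
        (L₁ / 2 + 2 * biasConst p Lp ^ α) * ∑ k ∈ Finset.range K, ((k : ℝ) + 4)⁻¹ +
        (youngConst α + 12 * ((2 * ((p - 1 : ℕ) : ℝ)) ^ α * σ ^ α)) *
          ∑ k ∈ Finset.range K, ((k : ℝ) + 4) ^ (-1 + noiseExp p α) := by
  have htel : ∀ K : ℕ, ∑ k ∈ Finset.range K,
        eta p k * ∫ ω, ‖gradient f (run G x₀ p (fun j t => ξ j t ω) k).x‖ ∂μ +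
        (∫ ω, f (run G x₀ p (fun j t => ξ j t ω) K).x ∂μ +
          potWeight p α K * ∫ ω, ‖err f G x₀ p (fun j t => ξ j t ω) K‖ ^ α ∂μ)
      ≤ f x₀ + (4 : ℝ) ^ ((1 : ℝ) / 3) * σ ^ α +
        (L₁ / 2 + 2 * biasConst p Lp ^ α) * ∑ k ∈ Finset.range K, ((k : ℝ) + 4)⁻¹ +
        (youngConst α + 12 * ((2 * ((p - 1 : ℕ) : ℝ)) ^ α * σ ^ α)) *
          ∑ k ∈ Finset.range K, ((k : ℝ) + 4) ^ (-1 + noiseExp p α) := by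
    intro K
    induction K with
    | zero =>
      have h0 := (moment_err_zero (x₀ := x₀) h hs.two_le_p hξ).2
      have hw := potWeight_zero_le (p := p) h.one_lt_α h.α_le_two
      have hx : ∀ ω, (run G x₀ p (fun j t => ξ j t ω) 0).x = x₀ := fun _ => rfl
      simp only [hx, Finset.range_zero, Finset.sum_empty, mul_zero, add_zero, zero_add,
        integral_const, probReal_univ, one_smul]
      gcongr
    | succ K ih =>
      have := potential_step (x₀ := x₀) h hs hξ K
      simp only [Finset.sum_range_succ, mul_add]
      linarith
  have hlow : flow ≤ ∫ ω, f (run G x₀ p (fun j t => ξ j t ω) K).x ∂μ := by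
    have := integral_mono (integrable_const flow) (integrable_value (x₀ := x₀) h hξ K)
      (fun ω => h.lower_bound _)
    simpa using this
  have hpos : 0 ≤ potWeight p α K * ∫ ω, ‖err f G x₀ p (fun j t => ξ j t ω) K‖ ^ α ∂μ :=
    mul_nonneg (potWeight_pos p α K).le (integral_nonneg fun ω => by positivity)
  linarith [htel K]

end Moments

/-! ### The uniformly drawn iterate -/

section UniformIndex

variable {Ξ : Type*} [MeasurableSpace Ξ] {Ω : Type*} [mΩ : MeasurableSpace Ω] {μ : Measure Ω}
  {q : ℕ} {ξ : ℕ → ℕ → Ω → Ξ} {K : ℕ} {ι : Ω → ℕ}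

lemma IsUniformIndex.measure_eq (h : IsUniformIndex μ q ξ K ι) {k : ℕ} (hk : k < K) :
    μ.real (ι ⁻¹' {k}) = (K : ℝ)⁻¹ := by
  have h1 : μ (ι ⁻¹' {k}) = uniformOn (Finset.range K : Set ℕ) {k} := by
    rw [← h.law, Measure.map_apply h.measurable (measurableSet_singleton k)]
  have h2 := uniformOn_apply_finset (s := Finset.range K) (t := {k})
  rw [Finset.coe_singleton] at h2
  have h3 : Finset.range K ∩ {k} = {k} :=
    Finset.inter_singleton_of_mem (Finset.mem_range.2 hk)
  rw [Measure.real, h1, h2, h3, Finset.card_singleton, Finset.card_range]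
  simp

variable [IsProbabilityMeasure μ]

lemma IsUniformIndex.ae_lt (h : IsUniformIndex μ q ξ K ι) (hK : 0 < K) : ∀ᵐ ω ∂μ, ι ω < K := by
  have h1 : μ (ι ⁻¹' (Finset.range K : Set ℕ)) = 1 := by
    rw [← Measure.map_apply h.measurable (Finset.measurableSet _), h.law]
    exact uniformOn_self (Finset.finite_toSet _) ⟨0, by simpa using hK⟩
  have h2 : ∀ᵐ ω ∂μ, ω ∈ ι ⁻¹' (Finset.range K : Set ℕ) :=
    (prob_compl_eq_zero_iff (h.measurable (Finset.measurableSet _))).2 h1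
  filter_upwards [h2] with ω hω
  simpa using hω

/-- The mean of a quantity, determined by the samples, at the uniformly drawn index is the average
of its means. -/
lemma IsUniformIndex.integral_eq (h : IsUniformIndex μ q ξ K ι)
    (hK : 0 < K) {φ : ℕ → Ω → ℝ}
    (hm : ∀ k, Measurable[past q ξ k] (φ k)) (hint : ∀ k, Integrable (φ k) μ) :
    Integrable (fun ω => φ (ι ω) ω) μ ∧
      ∫ ω, φ (ι ω) ω ∂μ = (K : ℝ)⁻¹ * ∑ k ∈ Finset.range K, ∫ ω, φ k ω ∂μ := by
  set χ : ℕ → ℕ → ℝ := fun k i => if i = k then 1 else 0 with hχ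
  have hχm : ∀ k, Measurable (χ k) := fun k => measurable_from_nat
  have hae : (fun ω => φ (ι ω) ω) =ᵐ[μ]
      fun ω => ∑ k ∈ Finset.range K, χ k (ι ω) * φ k ω := by
    filter_upwards [h.ae_lt hK] with ω hω
    rw [Finset.sum_eq_single_of_mem (ι ω) (Finset.mem_range.2 hω)]
    · simp [hχ]
    · intro k _ hk
      simp [hχ, hk.symm]
  have hindep : ∀ k, IndepFun (fun ω => χ k (ι ω)) (φ k) μ := by
    intro k
    have h1 : IndepFun ι (φ k) μ :=
      (IndepFun_iff_Indep _ _ _).2 (indep_of_indep_of_le_right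
        ((IndepFun_iff_Indep _ _ _).1 h.indep) ((hm k).comap_le.trans (past_le_comap k)))
    exact h1.comp (hχm k) measurable_id
  have hterm : ∀ k, Integrable (fun ω => χ k (ι ω) * φ k ω) μ := by
    intro k
    refine (hint k).bdd_mul (c := 1) ((hχm k).comp h.measurable).aestronglyMeasurable
      (Filter.Eventually.of_forall fun ω => ?_)
    by_cases hk : ι ω = k <;> simp [hχ, hk]
  have hval : ∀ k ∈ Finset.range K,
      ∫ ω, χ k (ι ω) * φ k ω ∂μ = (K : ℝ)⁻¹ * ∫ ω, φ k ω ∂μ := by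
    intro k hk
    rw [(hindep k).integral_fun_mul_eq_mul_integral
      ((hχm k).comp h.measurable).aestronglyMeasurable (hint k).aestronglyMeasurable]
    congr 1
    have e : (fun ω => χ k (ι ω)) = (ι ⁻¹' {k}).indicator 1 := by
      ext ω
      by_cases hω : ι ω = k
      · rw [Set.indicator_of_mem (by exact hω)]; simp [hχ, hω]
      · rw [Set.indicator_of_notMem (by exact hω)]; simp [hχ, hω]
    rw [e, integral_indicator_one (h.measurable (measurableSet_singleton k)),
      h.measure_eq (Finset.mem_range.1 hk)]
  refine ⟨(integrable_finsetSum _ fun k _ => hterm k).congr hae.symm, ?_⟩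
  rw [integral_congr_ae hae, integral_finsetSum _ fun k _ => hterm k, Finset.sum_congr rfl hval,
    Finset.mul_sum]

end UniformIndex

/-! ### Comparison with the constants of the threshold -/

section Constants

variable {p : ℕ} {α L₁ Lp σ : ℝ}

lemma two_mul_biasConst_rpow_le (h2 : α ≤ 2) (hLp : 0 < Lp) :
    2 * biasConst p Lp ^ α
      ≤ 306 * (p : ℝ) ^ (2 * (p : ℝ) * α) * Lp ^ α / (p.factorial : ℝ) ^ α := by
  have h3 : (3 : ℝ) ^ α ≤ 9 := by
    calc (3 : ℝ) ^ α ≤ 3 ^ (2 : ℝ) := Real.rpow_le_rpow_of_exponent_le (by norm_num) h2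
      _ = 9 := by norm_num
  have hpow : ((p : ℝ) ^ (2 * p)) ^ α = (p : ℝ) ^ (2 * (p : ℝ) * α) := by
    rw [← Real.rpow_natCast, ← Real.rpow_mul (Nat.cast_nonneg p)]
    push_cast; rfl
  have e : biasConst p Lp ^ α
      = 3 ^ α * ((p : ℝ) ^ (2 * (p : ℝ) * α) * Lp ^ α / (p.factorial : ℝ) ^ α) := by
    rw [biasConst, Real.div_rpow (by positivity) (by positivity),
      Real.mul_rpow (by positivity) hLp.le, Real.mul_rpow (by norm_num) (by positivity), hpow]
    ring
  have h0 : 0 ≤ (p : ℝ) ^ (2 * (p : ℝ) * α) * Lp ^ α / (p.factorial : ℝ) ^ α := by positivity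
  rw [e]
  calc _ ≤ 2 * (9 * ((p : ℝ) ^ (2 * (p : ℝ) * α) * Lp ^ α / (p.factorial : ℝ) ^ α)) := by gcongr
    _ ≤ 306 * ((p : ℝ) ^ (2 * (p : ℝ) * α) * Lp ^ α / (p.factorial : ℝ) ^ α) := by linarith
    _ = _ := by ring

lemma noise_const_le (h2 : α ≤ 2) (hσ : 0 < σ) (hp : 2 ≤ p) :
    12 * ((2 * ((p - 1 : ℕ) : ℝ)) ^ α * σ ^ α) ≤ 64 * ((p : ℝ) - 1) ^ α * σ ^ α := by
  have e : ((p - 1 : ℕ) : ℝ) = p - 1 := by rw [Nat.cast_sub (by omega), Nat.cast_one]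
  have hp' : (0 : ℝ) ≤ (p : ℝ) - 1 := by rw [← e]; positivity
  have h4 : (2 : ℝ) ^ α ≤ 4 := by
    calc (2 : ℝ) ^ α ≤ 2 ^ (2 : ℝ) := Real.rpow_le_rpow_of_exponent_le (by norm_num) h2
      _ = 4 := by norm_num
  have h0 : 0 ≤ ((p : ℝ) - 1) ^ α * σ ^ α := by positivity
  rw [e, Real.mul_rpow (by norm_num) hp']
  calc _ = 12 * 2 ^ α * (((p : ℝ) - 1) ^ α * σ ^ α) := by ring
    _ ≤ 12 * 4 * (((p : ℝ) - 1) ^ α * σ ^ α) := by gcongr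
    _ ≤ _ := by linarith

lemma Mhat_pos (h1 : 1 < α) (hσ : 0 < σ) (hp : 2 ≤ p) : 0 < Mhat p α σ := by
  have hp' : (2 : ℝ) ≤ p := by exact_mod_cast hp
  have h2 : 0 < (p : ℝ) - 1 := by linarith
  have h3 : 0 < α - 1 := by linarith
  unfold Mhat
  positivity

lemma Mtilde_pos {gap : ℝ} (hgap : 0 ≤ gap) (hL₁ : 0 < L₁) (hσ : 0 < σ) (hLp : 0 < Lp) :
    0 < Mtilde p α gap L₁ σ Lp := by
  unfold Mtilde
  positivity

end Constants

section Rate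

variable {n : ℕ} {Ξ : Type*} [MeasurableSpace Ξ] {P : Measure Ξ} [IsProbabilityMeasure P]
  {f : Eucl n → ℝ} {G : Eucl n → Ξ → Eucl n} {flow L₁ σ α : ℝ} {p : ℕ} {Lp : ℝ}
  {Ω : Type*} [mΩ : MeasurableSpace Ω] {μ : Measure Ω} [IsProbabilityMeasure μ]
  {ξ : ℕ → ℕ → Ω → Ξ} {x₀ : Eucl n}

/-- The convergence rate of the average gradient norm, up to logarithms
`K ^ (-p / (3p+1)) + K ^ (-2p(α-1) / ((3p+1)α))`. -/
lemma average_gradient_le (h : BasicAssumption P f G flow L₁ σ α)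
    (hs : HighSmoothAssumption f p Lp) (hξ : IsSampling μ P (p - 1) ξ) {K : ℕ} (hK : 5 ≤ K) :
    (K : ℝ)⁻¹ * ∑ k ∈ Finset.range K,
        ∫ ω, ‖gradient f (run G x₀ p (fun j t => ξ j t ω) k).x‖ ∂μ
      ≤ (Mtilde p α (f x₀ - flow) L₁ σ Lp *
            (K : ℝ) ^ (-(1 / ((3 * (p : ℝ) + 1) / p))) * Real.log K +
          Mhat p α σ *
            (K : ℝ) ^ (-(1 / ((3 * (p : ℝ) * α + α) / (2 * p * (α - 1))))) * Real.log K) / 2 := by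
  have h1 := h.one_lt_α
  have h2 := h.α_le_two
  have hL₁ := h.L₁_pos
  have hσ := h.σ_pos
  have hLp := hs.Lp_pos
  have hp := hs.two_le_p
  have hp0 : (0 : ℝ) < p := by exact_mod_cast (by omega : 0 < p)
  have hK5 : (5 : ℝ) ≤ K := by exact_mod_cast hK
  have hK0 : (0 : ℝ) < K := by linarith
  have hgap : 0 ≤ f x₀ - flow := sub_nonneg.2 (h.lower_bound x₀)
  set g : ℕ → ℝ := fun k => ∫ ω, ‖gradient f (run G x₀ p (fun j t => ξ j t ω) k).x‖ ∂μ with hg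
  have hg0 : ∀ k, 0 ≤ g k := fun k => integral_nonneg fun ω => norm_nonneg _
  have hlog : 1 ≤ Real.log K := by
    rw [Real.le_log_iff_exp_le hK0]
    have := Real.exp_one_lt_d9
    linarith
  have hD : 0 ≤ biasConst p Lp := by unfold biasConst; positivity
  have hY : 0 ≤ youngConst α := by
    have : 0 < α - 1 := by linarith
    unfold youngConst; positivity
  set u : ℝ := (K : ℝ) ^ (-((p : ℝ) / (3 * p + 1))) with hu
  have hu0 : 0 < u := by positivity
  set v : ℝ := (K : ℝ) ^ noiseExp p α with hv
  have hv0 : 0 < v := by positivity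
  have havg : (K : ℝ)⁻¹ * ∑ k ∈ Finset.range K, g k
      ≤ 2 * u * ∑ k ∈ Finset.range K, eta p k * g k := by
    rw [Finset.mul_sum, Finset.mul_sum]
    refine Finset.sum_le_sum fun k hk => ?_
    have := one_le_mul_eta (p := p) (by omega : 3 ≤ K) (Finset.mem_range.1 hk)
    rw [inv_mul_le_iff₀ hK0]
    calc g k = 1 * g k := (one_mul _).symm
      _ ≤ (2 * (K : ℝ) * u * eta p k) * g k := mul_le_mul_of_nonneg_right this (hg0 k)
      _ = _ := by ring
  have hsum := sum_eta_mul_gradient_le (x₀ := x₀) h hs hξ K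
  have hs1 := sum_inv_le_log (by omega : 2 ≤ K)
  have hs2 := sum_rpow_le (p := p) (by omega : 3 ≤ K) h1 h2
  have hc1 := two_mul_biasConst_rpow_le (p := p) h2 hLp
  have hc2 := noise_const_le h2 hσ hp
  have hfirst : f x₀ - flow + (4 : ℝ) ^ ((1 : ℝ) / 3) * σ ^ α +
      (L₁ / 2 + 2 * biasConst p Lp ^ α) * ∑ k ∈ Finset.range K, ((k : ℝ) + 4)⁻¹
      ≤ Mtilde p α (f x₀ - flow) L₁ σ Lp / 4 * Real.log K := by
    have ha : 0 ≤ f x₀ - flow + (4 : ℝ) ^ ((1 : ℝ) / 3) * σ ^ α := by positivity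
    have hb : (L₁ / 2 + 2 * biasConst p Lp ^ α) * ∑ k ∈ Finset.range K, ((k : ℝ) + 4)⁻¹
        ≤ (L₁ / 2 + 306 * (p : ℝ) ^ (2 * (p : ℝ) * α) * Lp ^ α / (p.factorial : ℝ) ^ α) *
          Real.log K := by gcongr
    have hc := le_mul_of_one_le_right ha hlog
    rw [Mtilde]
    linarith
  have hsecond : (youngConst α + 12 * ((2 * ((p - 1 : ℕ) : ℝ)) ^ α * σ ^ α)) *
      ∑ k ∈ Finset.range K, ((k : ℝ) + 4) ^ (-1 + noiseExp p α)
      ≤ Mhat p α σ / 4 * v * Real.log K := by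
    have hnn : 0 ≤ 64 * ((p : ℝ) - 1) ^ α * σ ^ α := le_trans (by positivity) hc2
    calc _ ≤ (youngConst α + 64 * ((p : ℝ) - 1) ^ α * σ ^ α) * (2 * v * Real.log K) := by gcongr
      _ = _ := by rw [Mhat, youngConst]; ring
  have hexp : u * v = (K : ℝ) ^ (-(1 / ((3 * (p : ℝ) * α + α) / (2 * p * (α - 1))))) := by
    rw [hu, hv, ← Real.rpow_add hK0]
    congr 1
    have : α - 1 ≠ 0 := by linarith
    have : α ≠ 0 := by linarith
    have hr : (0 : ℝ) < 3 * p + 1 := by positivity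
    rw [noiseExp, one_div_div, show 3 * (p : ℝ) * α + α = α * (3 * p + 1) by ring]
    field_simp
    ring
  have hexp' : (K : ℝ) ^ (-(1 / ((3 * (p : ℝ) + 1) / p))) = u := by rw [one_div_div]
  rw [← hexp, hexp']
  calc _ ≤ 2 * u * ∑ k ∈ Finset.range K, eta p k * g k := havg
    _ ≤ 2 * u * (Mtilde p α (f x₀ - flow) L₁ σ Lp / 4 * Real.log K +
          Mhat p α σ / 4 * v * Real.log K) := by
        gcongr
        linarith
    _ = _ := by ring

end Rate

end NSFOM

theorem theorem4 {n : ℕ} {Ξ : Type*} [MeasurableSpace Ξ] (P : Measure Ξ) [IsProbabilityMeasure P]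
    (f : NSFOM.Eucl n → ℝ) (G : NSFOM.Eucl n → Ξ → NSFOM.Eucl n) (flow L₁ σ α : ℝ)
    (hbasic : NSFOM.BasicAssumption P f G flow L₁ σ α)
    (p : ℕ) (Lp : ℝ) (hsmooth : NSFOM.HighSmoothAssumption f p Lp)
    {Ω : Type*} [MeasurableSpace Ω] (μ : Measure Ω) [IsProbabilityMeasure μ]
    (ξ : ℕ → ℕ → Ω → Ξ) (hξ : NSFOM.IsSampling μ P (p - 1) ξ)
    (x₀ : NSFOM.Eucl n) (x : ℕ → Ω → NSFOM.Eucl n)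
    (hx : ∀ k ω, x k ω = NSFOM.iterate G x₀ (p - 1) (NSFOM.eta p) (NSFOM.gammaT p) (NSFOM.theta p)
      (fun j t => ξ j t ω) k)
    (ε : ℝ) (hε₀ : 0 < ε) (hε₁ : ε < 1) (K : ℕ)
    (hK : NSFOM.threshold p α (f x₀ - flow) L₁ σ Lp ε ≤ (K : ℝ))
    (ι : Ω → ℕ) (hι : NSFOM.IsUniformIndex μ (p - 1) ξ K ι) :
    Integrable (fun ω => ‖gradient f (x (ι ω) ω)‖) μ ∧
      ∫ ω, ‖gradient f (x (ι ω) ω)‖ ∂μ ≤ ε := by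
  have h1 := hbasic.one_lt_α
  have hα : 0 < α - 1 := by linarith
  have hα0 : 0 < α := by linarith
  have hp := hsmooth.two_le_p
  have hp0 : (0 : ℝ) < p := by exact_mod_cast (by omega : 0 < p)
  have hgap : 0 ≤ f x₀ - flow := sub_nonneg.2 (hbasic.lower_bound x₀)
  have hMt := NSFOM.Mtilde_pos (p := p) (α := α) hgap hbasic.L₁_pos hbasic.σ_pos hsmooth.Lp_pos
  have hMh := NSFOM.Mhat_pos h1 hbasic.σ_pos hp
  simp only [NSFOM.threshold, max_le_iff] at hK
  obtain ⟨hKA, hKB, hK5⟩ := hK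
  have hK5' : 5 ≤ K := by exact_mod_cast hK5
  have hx' : ∀ k ω, x k ω = (NSFOM.run G x₀ p (fun j t => ξ j t ω) k).x := hx
  simp only [hx']
  obtain ⟨hint, hval⟩ := hι.integral_eq (by omega)
    (φ := fun k ω => ‖gradient f (NSFOM.run G x₀ p (fun j t => ξ j t ω) k).x‖)
    (fun k => (hbasic.continuous_gradient.norm.measurable).comp
      (NSFOM.measurable_run hbasic.measurable_G k).1)
    (fun k => NSFOM.integrable_norm_gradient hbasic hξ k)
  refine ⟨hint, ?_⟩
  rw [hval]
  have hA := NSFOM.mul_log_le_of_threshold (r := (3 * (p : ℝ) + 1) / p) (by positivity)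
    (by positivity) (by omega : 1 ≤ K) hε₀
    (M := NSFOM.Mtilde p α (f x₀ - flow) L₁ σ Lp) (by field_simp) hKA
  have hB := NSFOM.mul_log_le_of_threshold
    (r := (3 * (p : ℝ) * α + α) / (2 * p * (α - 1))) (by positivity) (by positivity)
    (by omega : 1 ≤ K) hε₀ (M := NSFOM.Mhat p α σ) (by field_simp; ring) hKB
  have hrate := NSFOM.average_gradient_le (x₀ := x₀) hbasic hsmooth hξ hK5'
  linarith
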